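/- Let $m,n\ge 1$ and $0\le t\le n$ be integers, and let $\lambda=[1^{n_1},2^{n_2},\dots,k^{n_k}]\vdash t$ be a partition with $l=n_1+\cdots+n_k$ parts. Realise the $m$-cluster complex $\Gamma^{(m)}(B_n)$ as the complex of $m$-divisible centrally symmetric dissections of a regular $(2mn+2)$-gon: a face is a half-turn invariant set of pairwise noncrossing diagonals cutting the polygon only into $(mi+2)$-gons with integers $i\ge 1$. A face has parabolic type $\lambda$ if, for every $i\ge1$, it cuts the polygon into either $2n_i$ or $2n_i+1$ subpolygons with $mi+2$ vertices (that is, $n_i$ is half their number, rounded down, where $n_i=0$ for $i>k$); let $\Gamma^{(m)}(B_n)_\lambda$ be the set of these faces, on which the cyclic group $C_{2mn+2}$ acts by rotating the polygon. With $[a]_q=1+q+\cdots+q^{a-1}$ and $[a]_q!=[1]_q[2]_q\cdots[a]_q$, put $$\mu_\lambda(q)=\begin{bmatrix} mn+l\\ n_1,\dots,n_k,\,mn\end{bmatrix}_{q^2}=\frac{[mn+l]_{q^2}!}{[n_1]_{q^2}!\cdots[n_k]_{q^2}!\,[mn]_{q^2}!}=\frac{\prod_{i=1}^{l}[2mn+2i]_q}{\prod_{j=1}^{k}\prod_{i=1}^{n_j}[2i]_q}.$$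 Then $\mu_\lambda(q)$ is a polynomial with integer coefficients and the triple $(\Gamma^{(m)}(B_n)_\lambda,\,C_{2mn+2},\,\mu_\lambda(q))$ exhibits the cyclic sieving phenomenon: for every $g\in C_{2mn+2}$, of order $d$ say, exactly $\mu_\lambda(e^{2\pi i/d})$ elements of $\Gamma^{(m)}(B_n)_\lambda$ are fixed by $g$. -/

import Mathlib

open Polynomial
open scoped Pointwise

namespace ClusterB

/-! ### Cyclic sieving -/

/-- Let the finite cyclic group `C` (written additively) act on `Ω`.  The triple `(X, C, P)` exhibits
the cyclic sieving phenomenon: `X` is a finite `C`-stable subset of `Ω`, and for each `g` in `C`, of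
order `d` say, the value of `P` at `exp (2πi/d)` is the number of elements of `X` fixed by `g`. -/
def ExhibitsCSP {C Ω : Type*} [AddGroup C] [Finite C] [IsAddCyclic C] [AddAction C Ω]
    (X : Set Ω) (P : ℤ[X]) : Prop :=
  X.Finite ∧ (∀ g : C, ∀ x ∈ X, g +ᵥ x ∈ X) ∧
    ∀ g : C, aeval (Complex.exp (2 * Real.pi * Complex.I / (addOrderOf g : ℂ))) P =
      ((Set.ncard {x ∈ X | g +ᵥ x = x} : ℕ) : ℂ)

/-! ### q-analogues -/

/-- The `q`-integer `[k]_q = 1 + q + ⋯ + q ^ (k - 1)`. -/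
noncomputable def qInt (k : ℕ) : ℤ[X] := ∑ i ∈ Finset.range k, X ^ i

/-- The `q`-factorial `[k]_q! = [1]_q [2]_q ⋯ [k]_q`. -/
noncomputable def qFactorial (k : ℕ) : ℤ[X] := ∏ i ∈ Finset.Icc 1 k, qInt i

/-- The `q`-multinomial coefficient `[a₁ + ⋯ + aᵣ]_q! / ([a₁]_q! ⋯ [aᵣ]_q!)` of the multiset
`{a₁, …, aᵣ}`: the polynomial quotient by the (monic) denominator. -/
noncomputable def qMultinomial (a : Multiset ℕ) : ℤ[X] :=
  qFactorial a.sum /ₘ (a.map qFactorial).prod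

/-! ### Dissections of a convex polygon

The vertices of the convex `N`-gon are labelled cyclically by `ZMod N`. -/

variable {N : ℕ}

/-- Going around the polygon from `a` in the positive direction, one meets `b` strictly after `a`
and strictly before `c`. -/
def Between (a b c : ZMod N) : Prop := 0 < (b - a).val ∧ (b - a).val < (c - a).val

/-- The set `e` of vertices consists of the two endpoints of a side of the polygon. -/
def IsSide (e : Finset (ZMod N)) : Prop := ∃ a : ZMod N, e = {a, a + 1}

/-- The set `e` of vertices consists of the two endpoints of a diagonal of the polygon. -/
def IsDiagonal (e : Finset (ZMod N)) : Prop := e.card = 2 ∧ ¬ IsSide e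

/-- The segments `e` and `f` cross in the interior of the polygon: their endpoints are distinct and
alternate around the polygon. -/
def Crosses (e f : Finset (ZMod N)) : Prop :=
  ∃ a b c d : ZMod N, e = {a, b} ∧ f = {c, d} ∧ Between a c b ∧ Between b d a

/-- A dissection of the polygon: a set of pairwise noncrossing diagonals. -/
def IsDissection (D : Finset (Finset (ZMod N))) : Prop :=
  (∀ e ∈ D, IsDiagonal e) ∧ ∀ e ∈ D, ∀ f ∈ D, ¬ Crosses e f

/-- `a` and `b` are adjacent vertices of the inscribed polygon with vertex set `S`: one of the two
open arcs between `a` and `b` contains no vertex in `S`. -/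
def Adjacent (S : Finset (ZMod N)) (a b : ZMod N) : Prop :=
  (∀ c ∈ S, ¬ Between a c b) ∨ (∀ c ∈ S, ¬ Between b c a)

/-- `S` is the vertex set of one of the polygons into which the dissection `D` cuts the `N`-gon: it
has at least three vertices, its sides are sides of the `N`-gon or diagonals in `D`, and no diagonal
in `D` joins two of its vertices that are not adjacent in it. -/
def IsSubgon (D : Finset (Finset (ZMod N))) (S : Finset (ZMod N)) : Prop :=
  3 ≤ S.card ∧
    ∀ a ∈ S, ∀ b ∈ S, a ≠ b → (Adjacent S a b ↔ IsSide {a, b} ∨ ({a, b} : Finset (ZMod N)) ∈ D)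

/-! ### The `m`-cluster complex of type `Bₙ` -/

/-- `D` is a face of the `m`-cluster complex of type `Bₙ`, realised as the complex of `m`-divisible
centrally symmetric dissections of the `(2mn + 2)`-gon: `D` is a dissection, it is invariant under
the half-turn (the rotation by `mn + 1` steps; so `D` is a set of diameters and centrally symmetric
pairs of diagonals), and each of the polygons into which it cuts the `(2mn + 2)`-gon is an
`(mk + 2)`-gon for some integer `k`. -/
def IsFace (m n : ℕ) (D : Finset (Finset (ZMod (2 * m * n + 2)))) : Prop :=
  IsDissection D ∧ ((m * n + 1 : ℕ) : ZMod (2 * m * n + 2)) +ᵥ D = D ∧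
    ∀ S, IsSubgon D S → ∃ k : ℕ, S.card = m * k + 2

/-- The number of `(mk + 2)`-gons into which `D` cuts the `(2mn + 2)`-gon. -/
noncomputable def subgonCount (m n : ℕ) (D : Finset (Finset (ZMod (2 * m * n + 2)))) (k : ℕ) : ℕ :=
  Set.ncard {S : Finset (ZMod (2 * m * n + 2)) | IsSubgon D S ∧ S.card = m * k + 2}

/-- The faces of parabolic type `lam`, a partition of some `t ≤ n`: for all `k`, the part `k` has
multiplicity `⌊c / 2⌋` in `lam`, where `c` is the number of `(mk + 2)`-gons into which the face cuts
the `(2mn + 2)`-gon. -/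
def facesOfType (m n : ℕ) {t : ℕ} (lam : t.Partition) :
    Set (Finset (Finset (ZMod (2 * m * n + 2)))) :=
  {D | IsFace m n D ∧ ∀ k, lam.parts.count k = subgonCount m n D k / 2}

/-- The numbers `mn, n₁, n₂, …`, where the `nᵢ` are the multiplicities of the distinct parts
of `lam`. -/
def lowerIndices (m n : ℕ) {t : ℕ} (lam : t.Partition) : Multiset ℕ :=
  (m * n) ::ₘ lam.parts.dedup.map fun i => lam.parts.count i

/-- The sieving polynomial: the `q`-multinomial coefficient with upper index `mn + l`, `l` being the
number of parts of `lam`, and lower indices `n₁, …, nₖ, mn`, taken at `q²`. -/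
noncomputable def sievingPoly (m n : ℕ) {t : ℕ} (lam : t.Partition) : ℤ[X] :=
  (qMultinomial (lowerIndices m n lam)).comp (X ^ 2)

end ClusterB

open Polynomial
open scoped Pointwise

namespace ClusterB

/-! ### `q`-integers, `q`-factorials and `q`-multinomial coefficients -/

/-! Put M = mn + 1, so that the polygon has 2M vertices. Centrally symmetric dissections lift to
M-periodic noncrossing systems of arcs (a, b) on the integers with 2 ≤ b - a ≤ M. Directly below
each arc lies one subpolygon; it has two vertices more than there are points whose smallest
enclosing arc (their parent) is that arc. The only other possible subpolygon is the central one, on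
the points under no arc. The half-turn pairs the former, so halving and rounding down counts arcs
per M-period (`ncard_subgons`).

For each a, the cell sizes of the arcs starting at a, in order, form a word, stored as the set of
its partial sums. The words determine the arcs: each of the b - a - 1 points inside an arc (a, b)
has a parent starting in [a, b), so b is a first return of the path whose up-steps are the word
weights (`reach_add_sum`, `isReturn`). Conversely, every M-periodic family of words of positive
letters with weight below M per period arises (`IsCode.isArcSystem`, `IsCode.code_arcsOf`). In type
λ the weight is mt ≤ mn < M, so there is no further condition: the faces correspond to the families
of M words whose letters, together, are m times the parts of λ.

Rotation translates the family. Hence a face is fixed by k steps exactly when its family has period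
r = gcd(M, k). With e = M/r, these are the families of r words with e-fold content λ: none unless e
divides every nᵢ, and otherwise (r - 1 + l/e)! / ((r - 1)! ∏ (nᵢ/e)!) of them (`ncard_words`). On
the algebraic side q² is a primitive e-th root of unity. Since mn ≡ -1 mod e, a surplus zero factor
[e] survives in the q-multinomial unless e divides every nᵢ; then everything cancels to the same
number (`aeval_sievingPoly_of_not_dvd`, `aeval_sievingPoly_of_dvd`). -/

theorem qInt_zero : qInt 0 = 0 := by simp [qInt]

theorem qInt_one : qInt 1 = 1 := by simp [qInt]

theorem qInt_add (a b : ℕ) : qInt (a + b) = qInt a + X ^ a * qInt b := by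
  simp [qInt, Finset.sum_range_add, Finset.mul_sum, pow_add]

theorem qInt_mul (e j : ℕ) : qInt (e * j) = qInt e * (qInt j).comp (X ^ e) := by
  induction j with
  | zero => simp [qInt_zero]
  | succ j ih =>
    rw [Nat.mul_succ, qInt_add, ih, qInt_add j 1, qInt_one]
    simp only [add_comp, mul_comp, pow_comp, X_comp, one_comp]
    ring

theorem qInt_monic {k : ℕ} (hk : k ≠ 0) : (qInt k).Monic :=
  monic_geom_sum_X hk

theorem qFactorial_zero : qFactorial 0 = 1 := by simp [qFactorial]

theorem qFactorial_succ (n : ℕ) : qFactorial (n + 1) = qFactorial n * qInt (n + 1) := by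
  rw [qFactorial, qFactorial, Finset.prod_Icc_succ_top (by omega)]

theorem qFactorial_monic (n : ℕ) : (qFactorial n).Monic :=
  monic_prod_of_monic _ _ fun i hi => qInt_monic (by have := (Finset.mem_Icc.1 hi).1; omega)

/-- The q-Pascal recurrence in divisibility form: split the top factor as [a+1] + q^(a+1) [b+1] and
apply induction to each summand. -/
theorem qFactorial_mul_dvd (a b : ℕ) : qFactorial a * qFactorial b ∣ qFactorial (a + b) := by
  induction a generalizing b with
  | zero => simp [qFactorial_zero]
  | succ a iha =>
    induction b with
    | zero => simp [qFactorial_zero]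
    | succ b ihb =>
      rw [show a + 1 + (b + 1) = (a + b + 1) + 1 by ring, qFactorial_succ (a + b + 1),
        show a + b + 1 + 1 = (a + 1) + (b + 1) by ring, qInt_add (a + 1) (b + 1), mul_add]
      refine dvd_add ?_ ?_
      · have := iha (b + 1)
        rw [← add_assoc] at this
        rw [qFactorial_succ a]
        calc qFactorial a * qInt (a + 1) * qFactorial (b + 1)
            = (qFactorial a * qFactorial (b + 1)) * qInt (a + 1) := by ring
          _ ∣ _ := mul_dvd_mul_right this _
      · rw [show a + 1 + b = a + b + 1 by ring] at ihb
        rw [qFactorial_succ b]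
        calc qFactorial (a + 1) * (qFactorial b * qInt (b + 1))
            = (qFactorial (a + 1) * qFactorial b) * qInt (b + 1) := by ring
          _ ∣ qFactorial (a + b + 1) * (X ^ (a + 1) * qInt (b + 1)) :=
            mul_dvd_mul ihb (dvd_mul_left _ _)

theorem prod_qFactorial_dvd (a : Multiset ℕ) : (a.map qFactorial).prod ∣ qFactorial a.sum := by
  induction a using Multiset.induction with
  | empty => simp [qFactorial_zero]
  | cons x s ih =>
    simp only [Multiset.map_cons, Multiset.prod_cons, Multiset.sum_cons]
    exact (mul_dvd_mul_left _ ih).trans (qFactorial_mul_dvd _ _)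

/-- The denominator is monic and divides the numerator, so the remainder of `/ₘ` vanishes and the
quotient is exact. -/
theorem qMultinomial_mul (a : Multiset ℕ) :
    qMultinomial a * (a.map qFactorial).prod = qFactorial a.sum := by
  have hm : ((a.map qFactorial).prod).Monic :=
    monic_multiset_prod_of_monic _ _ fun i _ => qFactorial_monic i
  rw [qMultinomial, mul_comm]
  have h := modByMonic_add_div (qFactorial a.sum) (a.map qFactorial).prod
  rwa [(modByMonic_eq_zero_iff_dvd hm).2 (prod_qFactorial_dvd a), zero_add] at h

theorem sum_lowerIndices (m n : ℕ) {t : ℕ} (lam : t.Partition) :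
    (lowerIndices m n lam).sum = m * n + lam.parts.card := by
  rw [lowerIndices, Multiset.sum_cons]
  congr 1
  exact Multiset.toFinset_sum_count_eq lam.parts

theorem sievingPoly_mul (m n : ℕ) {t : ℕ} (lam : t.Partition) :
    sievingPoly m n lam *
        ((lowerIndices m n lam).map fun a => (qFactorial a).comp (X ^ 2)).prod =
      (qFactorial (m * n + lam.parts.card)).comp (X ^ 2) := by
  have h := congrArg (fun p : ℤ[X] => p.comp (X ^ 2)) (qMultinomial_mul (lowerIndices m n lam))
  simp only [mul_comp, sum_lowerIndices] at h
  rw [← h, sievingPoly]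
  congr 1
  rw [multiset_prod_comp, Multiset.map_map]
  rfl

theorem prod_map_lowerIndices {R : Type*} [CommMonoid R] (f : ℕ → R) (m n : ℕ) {t : ℕ}
    (lam : t.Partition) : ((lowerIndices m n lam).map f).prod =
      f (m * n) * ∏ k ∈ lam.parts.toFinset, f (lam.parts.count k) := by
  rw [lowerIndices, Multiset.map_cons, Multiset.prod_cons, Multiset.map_map]
  rfl

theorem qInt_two_pow_mul_qFactorial_comp (k : ℕ) :
    qInt 2 ^ k * (qFactorial k).comp (X ^ 2) = ∏ i ∈ Finset.Icc 1 k, qInt (2 * i) := by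
  induction k with
  | zero => simp [qFactorial_zero]
  | succ k ih =>
    rw [Finset.prod_Icc_succ_top (by omega), ← ih, qFactorial_succ, qInt_mul, mul_comp]
    ring

theorem qInt_two_pow_mul_qFactorial_add_comp (a l : ℕ) :
    qInt 2 ^ l * (qFactorial (a + l)).comp (X ^ 2) =
      (qFactorial a).comp (X ^ 2) * ∏ i ∈ Finset.Icc 1 l, qInt (2 * a + 2 * i) := by
  induction l with
  | zero => simp
  | succ l ih =>
    rw [Finset.prod_Icc_succ_top (by omega), ← mul_assoc, ← ih, ← add_assoc, qFactorial_succ,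
      ← mul_add, ← add_assoc, qInt_mul, mul_comp]
    ring

/-- Since [2i]_q = [2]_q [i]_{q²}, passing between the two product forms costs a factor [2]_q per
index. There are l of them on either side, because the multiplicities add up to l. -/
theorem sievingPoly_mul_prod (m n : ℕ) {t : ℕ} (lam : t.Partition) :
    sievingPoly m n lam *
        ∏ k ∈ lam.parts.toFinset, ∏ i ∈ Finset.Icc 1 (lam.parts.count k), qInt (2 * i) =
      ∏ i ∈ Finset.Icc 1 lam.parts.card, qInt (2 * m * n + 2 * i) := by
  have h := sievingPoly_mul m n lam
  rw [prod_map_lowerIndices] at h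
  have h0 : (qFactorial (m * n)).comp (X ^ 2) ≠ 0 := by
    refine fun h => (qFactorial_monic (m * n)).comp (q := X ^ 2) (by monicity) (by simp) |>.ne_zero h
  apply mul_left_cancel₀ h0
  rw [show 2 * m * n = 2 * (m * n) by ring, ← qInt_two_pow_mul_qFactorial_add_comp, ← h]
  simp_rw [← qInt_two_pow_mul_qFactorial_comp]
  rw [Finset.prod_mul_distrib, Finset.prod_pow_eq_pow_sum, Multiset.toFinset_sum_count_eq]
  ring

/-! ### Values at roots of unity -/

/-- The `q`-factorial with one factor `[e]_q` removed from every `[i]_q` with `e ∣ i`. -/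
noncomputable def qFactorialPart (e n : ℕ) : ℤ[X] :=
  ∏ i ∈ Finset.Icc 1 n, if e ∣ i then (qInt (i / e)).comp (X ^ e) else qInt i

theorem qFactorialPart_succ (e n : ℕ) : qFactorialPart e (n + 1) = qFactorialPart e n *
    if e ∣ n + 1 then (qInt ((n + 1) / e)).comp (X ^ e) else qInt (n + 1) := by
  rw [qFactorialPart, qFactorialPart, Finset.prod_Icc_succ_top (by omega)]

/-- Isolates the factors that vanish at a primitive e-th root of unity: [i]_q = [e]_q [i/e]_{q^e}
for each of the ⌊n/e⌋ multiples i of e. -/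
theorem qFactorial_eq_mul_part {e : ℕ} (n : ℕ) :
    qFactorial n = qInt e ^ (n / e) * qFactorialPart e n := by
  induction n with
  | zero => simp [qFactorial_zero, qFactorialPart]
  | succ n ih =>
    rw [qFactorial_succ, ih, qFactorialPart_succ, Nat.succ_div]
    split_ifs with h
    · conv_lhs => rw [← Nat.mul_div_cancel' h, qInt_mul]
      rw [Nat.succ_div, if_pos h]
      ring
    · ring

theorem aeval_qInt_mul_sub (z : ℂ) (k : ℕ) : aeval z (qInt k) * (z - 1) = z ^ k - 1 := by
  simp [qInt, geom_sum_mul]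

theorem aeval_qInt_ne_zero {z : ℂ} {e : ℕ} (hz : IsPrimitiveRoot z e) {s : ℕ} (h0 : s ≠ 0)
    (hs : s < e) : aeval z (qInt s) ≠ 0 := by
  intro h
  have := aeval_qInt_mul_sub z s
  rw [h, zero_mul] at this
  exact hz.pow_ne_one_of_pos_of_lt h0 hs (sub_eq_zero.1 this.symm)

theorem aeval_qInt_self {z : ℂ} {e : ℕ} (hz : IsPrimitiveRoot z e) (he : 1 < e) :
    aeval z (qInt e) = 0 := by
  have := aeval_qInt_mul_sub z e
  rw [hz.pow_eq_one, sub_self] at this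
  exact (mul_eq_zero.1 this).resolve_right (sub_ne_zero.2 (hz.ne_one he))

theorem aeval_qFactorial_ne_zero {z : ℂ} {e : ℕ} (hz : IsPrimitiveRoot z e) {s : ℕ}
    (hs : s < e) : aeval z (qFactorial s) ≠ 0 := by
  rw [qFactorial, map_prod]
  refine Finset.prod_ne_zero_iff.2 fun i hi => ?_
  have := Finset.mem_Icc.1 hi
  exact aeval_qInt_ne_zero hz (by omega) (by omega)

/-- At z the q-integer [i] depends only on i mod e, so each complete block of e factors contributes
[e-1]!, and its last factor, the reduced multiple ej of e, contributes [j] at z^e = 1, that is j. -/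
theorem aeval_qFactorialPart {z : ℂ} {e : ℕ} (hz : IsPrimitiveRoot z e) (p s : ℕ) (hs : s < e) :
    aeval z (qFactorialPart e (e * p + s)) =
      (p.factorial : ℂ) * aeval z (qFactorial (e - 1)) ^ p * aeval z (qFactorial s) := by
  have step : ∀ p : ℕ, aeval z (qFactorialPart e (e * p)) =
      (p.factorial : ℂ) * aeval z (qFactorial (e - 1)) ^ p → ∀ s < e,
      aeval z (qFactorialPart e (e * p + s)) =
      (p.factorial : ℂ) * aeval z (qFactorial (e - 1)) ^ p * aeval z (qFactorial s) := by
    intro p hp s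
    induction s with
    | zero => intro _; simp [hp, qFactorial_zero]
    | succ s ih =>
      intro hs
      have hnd : ¬ e ∣ e * p + s + 1 := by
        rw [add_assoc, Nat.dvd_add_right (dvd_mul_right _ _)]
        exact Nat.not_dvd_of_pos_of_lt (by omega) hs
      rw [← add_assoc, qFactorialPart_succ, if_neg hnd, qFactorial_succ, map_mul, map_mul,
        ih (by omega), add_assoc, qInt_add, qInt_mul]
      simp only [map_add, map_mul, map_pow, aeval_X, aeval_qInt_self hz (by omega), pow_mul,
        hz.pow_eq_one]
      ring
  have base : ∀ p : ℕ, aeval z (qFactorialPart e (e * p)) =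
      (p.factorial : ℂ) * aeval z (qFactorial (e - 1)) ^ p := by
    intro p
    induction p with
    | zero => simp [qFactorialPart]
    | succ p ih =>
      -- The block is filled up to e - 1; the one remaining factor, at the index e(p + 1),
      -- contributes p + 1.
      have h := step p ih (e - 1) (by omega)
      have hidx : e * (p + 1) = e * p + (e - 1) + 1 := by
        rw [add_assoc, Nat.sub_add_cancel (by omega), Nat.mul_succ]
      rw [hidx, qFactorialPart_succ, ← hidx, if_pos (dvd_mul_right _ _),
        Nat.mul_div_cancel_left _ (by omega), map_mul, h, aeval_comp]
      simp only [map_pow, aeval_X, hz.pow_eq_one, qInt, map_sum, one_pow, Finset.sum_const,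
        Finset.card_range, Nat.factorial_succ]
      push_cast
      simp only [nsmul_eq_mul, Nat.cast_add, Nat.cast_one, mul_one]
      ring
  exact step p (base p) s hs

/-- Here δ is the order to which [e]_q survives in the q-multinomial; the other factors do not
vanish at a primitive e-th root of unity. -/
theorem qMultinomial_mul_part (m n : ℕ) {t : ℕ} (lam : t.Partition) {e : ℕ} (he : 0 < e)
    {δ : ℕ} (hδ : (m * n + lam.parts.card) / e =
      δ + (m * n / e + ∑ k ∈ lam.parts.toFinset, lam.parts.count k / e)) :
    qMultinomial (lowerIndices m n lam) * (qFactorialPart e (m * n) *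
      ∏ k ∈ lam.parts.toFinset, qFactorialPart e (lam.parts.count k)) =
      qInt e ^ δ * qFactorialPart e (m * n + lam.parts.card) := by
  have h := qMultinomial_mul (lowerIndices m n lam)
  rw [prod_map_lowerIndices, sum_lowerIndices, qFactorial_eq_mul_part (e := e) (m * n + _), hδ,
    qFactorial_eq_mul_part (e := e) (m * n),
    Finset.prod_congr rfl fun k _ => qFactorial_eq_mul_part (e := e) (lam.parts.count k),
    Finset.prod_mul_distrib, Finset.prod_pow_eq_pow_sum] at h
  have h0 : qInt e ^ (m * n / e + ∑ k ∈ lam.parts.toFinset, lam.parts.count k / e) ≠ 0 :=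
    pow_ne_zero _ (qInt_monic he.ne').ne_zero
  apply mul_left_cancel₀ h0
  rw [pow_add] at h ⊢
  rw [pow_add _ (m * n / e)] at h
  linear_combination h

theorem aeval_sievingPoly (m n : ℕ) {t : ℕ} (lam : t.Partition) (q : ℂ) :
    aeval q (sievingPoly m n lam) = aeval (q ^ 2) (qMultinomial (lowerIndices m n lam)) := by
  rw [sievingPoly, aeval_comp]
  simp

/-- With all multiplicities divisible by e, both mn and mn + l leave remainder e - 1, so no factor
[e] survives and the powers of [e-1]! balance. Only ordinary factorials remain. -/
theorem aeval_sievingPoly_of_dvd (m n : ℕ) {t : ℕ} (lam : t.Partition) {q : ℂ} {e r : ℕ}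
    (hq : IsPrimitiveRoot (q ^ 2) e) (hM : m * n + 1 = e * (r + 1))
    {p : Multiset ℕ} (hp : lam.parts = e • p) :
    aeval q (sievingPoly m n lam) * ((r.factorial : ℂ) * ∏ k ∈ p.toFinset, (p.count k).factorial) =
      (r + p.card).factorial := by
  have he : 0 < e := Nat.pos_of_ne_zero (by rintro rfl; simp at hM)
  have hmn : m * n = e * r + (e - 1) := by rw [Nat.mul_succ] at hM; omega
  have hcard : lam.parts.card = e * p.card := by rw [hp]; simp
  have hcount : ∀ k, lam.parts.count k = e * p.count k := by intro k; rw [hp]; simp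
  have hfin : lam.parts.toFinset = p.toFinset := by
    rw [hp]; exact Multiset.toFinset_nsmul _ _ he.ne'
  have hsum : m * n + lam.parts.card = e * (r + p.card) + (e - 1) := by rw [hmn, hcard]; ring
  have hdiv : ∀ x, (e * x + (e - 1)) / e = x := fun x => by
    rw [Nat.mul_add_div he, Nat.div_eq_of_lt (by omega), add_zero]
  have h := qMultinomial_mul_part m n lam he (δ := 0) (by
    rw [hsum, hdiv, hmn, hdiv, hfin, zero_add, ← Multiset.toFinset_sum_count_eq p]
    congr 1
    exact Finset.sum_congr rfl fun k _ => by rw [hcount, Nat.mul_div_cancel_left _ he])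
  have h := congrArg (aeval (q ^ 2)) h
  rw [hsum, hmn, hfin, pow_zero, one_mul, map_mul, map_mul, map_prod, ← aeval_sievingPoly,
    aeval_qFactorialPart hq _ _ (by omega), aeval_qFactorialPart hq _ _ (by omega)] at h
  have hpart : ∀ k, aeval (q ^ 2) (qFactorialPart e (lam.parts.count k)) =
      ((p.count k).factorial : ℂ) * aeval (q ^ 2) (qFactorial (e - 1)) ^ p.count k := fun k => by
    have := aeval_qFactorialPart hq (p.count k) 0 he
    rw [hcount]
    simpa [qFactorial_zero] using this
  simp_rw [hpart] at h
  rw [Finset.prod_mul_distrib, Finset.prod_pow_eq_pow_sum, Multiset.toFinset_sum_count_eq] at h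
  have hK : aeval (q ^ 2) (qFactorial (e - 1)) ≠ 0 := aeval_qFactorial_ne_zero hq (by omega)
  apply mul_right_cancel₀ (pow_ne_zero (r + p.card + 1) hK)
  generalize aeval (q ^ 2) (qFactorial (e - 1)) = K at h ⊢
  push_cast
  linear_combination h

/-- If e fails to divide some multiplicity, then l exceeds e Σ ⌊nₖ/e⌋. As mn is one short of a
multiple of e, this carries ⌊(mn + l)/e⌋ past the sum of the lower floors, leaving a zero factor
[e]. -/
theorem aeval_sievingPoly_of_not_dvd (m n : ℕ) {t : ℕ} (lam : t.Partition) {q : ℂ} {e r : ℕ}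
    (hq : IsPrimitiveRoot (q ^ 2) e) (hM : m * n + 1 = e * (r + 1))
    (hp : ∃ k, ¬ e ∣ lam.parts.count k) : aeval q (sievingPoly m n lam) = 0 := by
  obtain ⟨k₀, hk₀⟩ := hp
  have he : 1 < e := by
    rcases e with _ | _ | e
    · simp at hM
    · simp at hk₀
    · omega
  have hmn : m * n = e * r + (e - 1) := by rw [Nat.mul_succ] at hM; omega
  have hdiv : m * n / e = r := by
    rw [hmn, Nat.mul_add_div (by omega), Nat.div_eq_of_lt (by omega), add_zero]
  have hlt : e * ∑ k ∈ lam.parts.toFinset, lam.parts.count k / e < lam.parts.card := by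
    rw [← Multiset.toFinset_sum_count_eq, Finset.mul_sum]
    refine Finset.sum_lt_sum (fun k _ => Nat.mul_div_le _ _) ⟨k₀, ?_, ?_⟩
    · rw [Multiset.mem_toFinset, ← Multiset.count_ne_zero]
      rintro h; simp [h] at hk₀
    · refine lt_of_le_of_ne (Nat.mul_div_le _ _) fun h => hk₀ ⟨_, h.symm⟩
  have hge : r + ∑ k ∈ lam.parts.toFinset, lam.parts.count k / e + 1 ≤
      (m * n + lam.parts.card) / e := by
    rw [Nat.le_div_iff_mul_le (by omega)]
    nlinarith
  obtain ⟨δ, hδ⟩ := Nat.exists_eq_add_of_le hge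
  have h := qMultinomial_mul_part m n lam (e := e) (by omega) (δ := δ + 1) (by rw [hδ, hdiv]; ring)
  have h := congrArg (aeval (q ^ 2)) h
  have hne : ∀ x, aeval (q ^ 2) (qFactorialPart e x) ≠ 0 := fun x => by
    rw [← Nat.div_add_mod x e, aeval_qFactorialPart hq _ _ (Nat.mod_lt _ (by omega))]
    exact mul_ne_zero (mul_ne_zero (by exact_mod_cast Nat.factorial_ne_zero _)
      (pow_ne_zero _ (aeval_qFactorial_ne_zero hq (by omega))))
      (aeval_qFactorial_ne_zero hq (Nat.mod_lt _ (by omega)))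
  rw [map_mul, map_mul, map_prod, map_mul, map_pow, aeval_qInt_self hq he, zero_pow (by omega),
    zero_mul, ← aeval_sievingPoly] at h
  refine (mul_eq_zero.1 h).resolve_right (mul_ne_zero (hne _) (Finset.prod_ne_zero_iff.2 fun k _ =>
    hne _))

/-! ### Families of words with prescribed total content -/

theorem prod_count_factorial_erase {p : Multiset ℕ} {i : ℕ} (hi : i ∈ p) :
    ∏ k ∈ p.toFinset, (p.count k).factorial =
      p.count i * ∏ k ∈ (p.erase i).toFinset, ((p.erase i).count k).factorial := by
  have hsub : (p.erase i).toFinset ⊆ p.toFinset :=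
    Multiset.toFinset_subset.2 (Multiset.erase_subset _ _)
  rw [Finset.prod_subset hsub (f := fun k => ((p.erase i).count k).factorial) (fun k _ hk => by
    rw [Multiset.mem_toFinset, ← Multiset.count_eq_zero] at hk
    simp [hk])]
  have hi' := Multiset.mem_toFinset.2 hi
  rw [← Finset.mul_prod_erase _ _ hi',
    ← Finset.mul_prod_erase _ (fun k => ((p.erase i).count k).factorial) hi', ← mul_assoc]
  congr 1
  · rw [Multiset.count_erase_self, Nat.mul_factorial_pred]
    exact (Multiset.count_pos.2 hi).ne'
  · refine Finset.prod_congr rfl fun k hk => ?_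
    rw [Multiset.count_erase_of_ne (Finset.ne_of_mem_erase hk)]

/-- Look at the first word: either it is empty, leaving r words, or it starts with some i ∈ p, which
can be removed. After multiplication by ∏ pₖ! this becomes the recurrence r^(k+1) + (k+1)(r+1)^(k) =
(r+1)^(k+1) for rising factorials, where |p| = k + 1. Building the finset explicitly also gives
finiteness. -/
theorem exists_finset_words (r : ℕ) : ∀ p : Multiset ℕ, ∃ S : Finset (Fin r → List ℕ),
    (∀ c, c ∈ S ↔ ∑ a, (c a : Multiset ℕ) = p) ∧
      S.card * ∏ k ∈ p.toFinset, (p.count k).factorial = r.ascFactorial p.card := by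
  classical
  induction r with
  | zero =>
    intro p
    rcases eq_or_ne p 0 with rfl | hp
    · exact ⟨Finset.univ, fun c => ⟨fun _ => rfl, fun _ => Finset.mem_univ _⟩, by simp⟩
    · refine ⟨∅, fun c => by simpa using hp.symm, ?_⟩
      obtain ⟨k, hk⟩ := Nat.exists_eq_succ_of_ne_zero (mt Multiset.card_eq_zero.1 hp)
      simp [hk, Nat.zero_ascFactorial]
  | succ r ihr =>
    intro p
    induction h : p.card generalizing p with
    | zero =>
      obtain rfl := Multiset.card_eq_zero.1 h
      refine ⟨{fun _ => []}, fun c => ?_, by simp⟩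
      simp [funext_iff]
    | succ k ih =>
      obtain ⟨S₀, hS₀, hc₀⟩ := ihr p
      have ih' : ∀ i : p.toFinset, ∃ S : Finset (Fin (r + 1) → List ℕ),
          (∀ c, c ∈ S ↔ ∑ a, (c a : Multiset ℕ) = p.erase i) ∧
          S.card * ∏ j ∈ (p.erase i).toFinset, ((p.erase i).count j).factorial =
            (r + 1).ascFactorial k := fun i => ih _ (by
        rw [Multiset.card_erase_of_mem (Multiset.mem_toFinset.1 i.2), h]; rfl)
      choose S hS hc using ih'
      let f₀ : (Fin r → List ℕ) ↪ (Fin (r + 1) → List ℕ) :=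
        ⟨fun c => Fin.cons [] c, fun c d hcd => (Fin.cons_injective2 hcd).2⟩
      let f : ℕ → (Fin (r + 1) → List ℕ) ↪ (Fin (r + 1) → List ℕ) := fun i =>
        ⟨fun c => Fin.cons (i :: c 0) (Fin.tail c), fun c d hcd => by
          have h1 := congrFun hcd 0
          have h2 := (Fin.cons_injective2 hcd).2
          simp only [Fin.cons_zero, List.cons.injEq, true_and] at h1
          rw [← Fin.cons_self_tail c, ← Fin.cons_self_tail d, h1, h2]⟩
      have hf0 : ∀ i c, f i c 0 = i :: c 0 := fun i c => rfl
      have hf₀0 : ∀ c, f₀ c 0 = [] := fun c => rfl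
      have hft : ∀ i c, Fin.tail (f i c) = Fin.tail c := fun i c => rfl
      have hf₀t : ∀ c, Fin.tail (f₀ c) = c := fun c => rfl
      -- `f₀` prepends an empty word to the family; `f i` prepends the letter i to its first word.
      refine ⟨S₀.map f₀ ∪ Finset.univ.biUnion fun i : p.toFinset => (S i).map (f i), ?_, ?_⟩
      · intro c
        simp only [Finset.mem_union, Finset.mem_map, Finset.mem_biUnion, Finset.mem_univ, true_and]
        rw [← Fin.cons_self_tail c]
        rcases hc0 : c 0 with _ | ⟨i, l⟩
        · rw [Fin.sum_univ_succ]
          simp only [Fin.cons_zero, Fin.cons_succ, Multiset.coe_nil, zero_add]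
          rw [← hS₀]
          constructor
          · rintro (⟨d, hd, hd'⟩ | ⟨i, d, hd, hd'⟩)
            · have h2 := congrArg Fin.tail hd'
              rw [hf₀t, Fin.tail_cons] at h2
              rwa [← h2]
            · have := congrFun hd' 0
              simp [hf0] at this
          · exact fun hd => Or.inl ⟨_, hd, rfl⟩
        · rw [Fin.sum_univ_succ]
          simp only [Fin.cons_zero, Fin.cons_succ]
          constructor
          · rintro (⟨d, hd, hd'⟩ | ⟨j, d, hd, hd'⟩)
            · have := congrFun hd' 0
              simp [hf₀0] at this
            · have h1 := congrFun hd' 0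
              have h2 := congrArg Fin.tail hd'
              rw [hft, Fin.tail_cons] at h2
              simp only [hf0, Fin.cons_zero, List.cons.injEq] at h1
              rw [hS, Fin.sum_univ_succ] at hd
              rw [← h1.1, ← h1.2, ← h2, ← Multiset.cons_coe, Multiset.cons_add]
              change (j : ℕ) ::ₘ (_ + ∑ i : Fin r, (d i.succ : Multiset ℕ)) = p
              rw [hd]
              exact Multiset.cons_erase (Multiset.mem_toFinset.1 j.2)
          · intro hd
            have hi : i ∈ p := by rw [← hd]; simp
            refine Or.inr ⟨⟨i, Multiset.mem_toFinset.2 hi⟩, Fin.cons l (Fin.tail c), ?_, ?_⟩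
            · rw [hS, Fin.sum_univ_succ]
              simp only [Fin.cons_zero, Fin.cons_succ]
              rw [← hd, ← Multiset.cons_coe, Multiset.cons_add, Multiset.erase_cons_head]
            · rfl
      · have hdisj : Disjoint (S₀.map f₀)
            (Finset.univ.biUnion fun i : p.toFinset => (S i).map (f i)) := by
          rw [Finset.disjoint_left]
          intro c h1 h2
          simp only [Finset.mem_map, Finset.mem_biUnion, Finset.mem_univ, true_and] at h1 h2
          obtain ⟨d, -, rfl⟩ := h1
          obtain ⟨i, e, -, he⟩ := h2
          have := congrFun he 0
          simp [hf0, hf₀0] at this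
        rw [Finset.card_union_of_disjoint hdisj, Finset.card_biUnion, Finset.card_map]
        · simp only [Finset.card_map]
          have hterm : ∀ i : p.toFinset, (S i).card * ∏ k ∈ p.toFinset, (p.count k).factorial =
              p.count (i : ℕ) * (r + 1).ascFactorial k := fun i => by
            rw [prod_count_factorial_erase (Multiset.mem_toFinset.1 i.2), ← hc i]
            ring
          rw [add_mul, Finset.sum_mul, Finset.sum_congr rfl fun i _ => hterm i, ← Finset.sum_mul,
            Finset.univ_eq_attach, Finset.sum_attach p.toFinset fun i => p.count i,
            Multiset.toFinset_sum_count_eq, hc₀, h, Nat.ascFactorial_succ, Nat.ascFactorial_succ,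
            ← Nat.succ_ascFactorial]
          simp only [Nat.succ_eq_add_one]
          ring
        · intro i _ j _ hij
          rw [Function.onFun, Finset.disjoint_left]
          intro c h1 h2
          simp only [Finset.mem_map] at h1 h2
          obtain ⟨d, -, rfl⟩ := h1
          obtain ⟨e, -, he⟩ := h2
          have := congrFun he 0
          simp only [hf0, List.cons.injEq] at this
          exact hij (Subtype.ext this.1.symm)

theorem ncard_words (r : ℕ) (p : Multiset ℕ) :
    {c : Fin (r + 1) → List ℕ | ∑ a, (c a : Multiset ℕ) = p}.ncard *
      (r.factorial * ∏ k ∈ p.toFinset, (p.count k).factorial) = (r + p.card).factorial := by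
  obtain ⟨S, hS, hc⟩ := exists_finset_words (r + 1) p
  rw [show {c : Fin (r + 1) → List ℕ | ∑ a, (c a : Multiset ℕ) = p} = (S : Set _) from
    Set.ext fun c => (hS c).symm, Set.ncard_coe_finset, ← Nat.factorial_mul_ascFactorial, ← hc]
  ring

/-! ### Partial sums of words -/

/-- The set of sums of the nonempty final segments of a word. -/
def partialSums : List ℕ → Finset ℕ
  | [] => ∅
  | i :: l => insert (i + l.sum) (partialSums l)

/-- The multiset of gaps between consecutive elements of `{0} ∪ V`. -/
def gaps (V : Finset ℕ) : Multiset ℕ := V.val.map fun v => v - (V.filter (· < v)).sup id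

theorem sup_partialSums (l : List ℕ) : (partialSums l).sup id = l.sum := by
  induction l with
  | nil => simp [partialSums]
  | cons i l ih => simp [partialSums, ih]

theorem le_sum_of_mem_partialSums {l : List ℕ} {v : ℕ} (hv : v ∈ partialSums l) : v ≤ l.sum := by
  rw [← sup_partialSums]
  exact Finset.le_sup (f := id) hv

theorem zero_notMem_partialSums {l : List ℕ} (hl : ∀ i ∈ l, 0 < i) : 0 ∉ partialSums l := by
  induction l with
  | nil => simp [partialSums]
  | cons i l ih =>
    have := hl i (by simp)
    simp only [partialSums, Finset.mem_insert, not_or]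
    exact ⟨by omega, ih fun j hj => hl j (by simp [hj])⟩

theorem gaps_partialSums {l : List ℕ} (hl : ∀ i ∈ l, 0 < i) : gaps (partialSums l) = l := by
  induction l with
  | nil => rfl
  | cons i l ih =>
    have hi := hl i (by simp)
    have hmem : i + l.sum ∉ partialSums l := fun h => by
      have := le_sum_of_mem_partialSums h; omega
    rw [gaps, partialSums, Finset.insert_val_of_notMem hmem, Multiset.map_cons,
      ← Multiset.cons_coe, ← ih fun j hj => hl j (by simp [hj])]
    congr 1
    · rw [Finset.filter_insert, if_neg (lt_irrefl _), Finset.filter_true_of_mem fun v hv => by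
        have := le_sum_of_mem_partialSums hv; omega, sup_partialSums]
      omega
    · refine Multiset.map_congr rfl fun v hv => ?_
      have := le_sum_of_mem_partialSums (Finset.mem_def.2 hv)
      rw [Finset.filter_insert, if_neg (by omega)]

/-- The largest partial sum is the total, and positivity makes it new; erasing it leaves the partial
sums of the tail. -/
theorem partialSums_injective {l l' : List ℕ} (hl : ∀ i ∈ l, 0 < i) (hl' : ∀ i ∈ l', 0 < i)
    (h : partialSums l = partialSums l') : l = l' := by
  induction l generalizing l' with
  | nil =>
    rcases l' with _ | ⟨j, l'⟩
    · rfl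
    · exact absurd h.symm (Finset.insert_ne_empty _ _)
  | cons i l ih =>
    rcases l' with _ | ⟨j, l'⟩
    · simp [partialSums] at h
    · have hs : i + l.sum = j + l'.sum := by
        simpa [sup_partialSums] using congrArg (fun V => V.sup id) h
      have hi := hl i (by simp)
      have hj := hl' j (by simp)
      have h1 : i + l.sum ∉ partialSums l := fun h => by
        have := le_sum_of_mem_partialSums h; omega
      have h2 : j + l'.sum ∉ partialSums l' := fun h => by
        have := le_sum_of_mem_partialSums h; omega
      have h3 : partialSums l = partialSums l' := by
        rw [← Finset.erase_insert h1, ← Finset.erase_insert h2, ← hs]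
        rw [partialSums, partialSums, ← hs] at h
        rw [h]
      obtain rfl := ih (fun k hk => hl k (by simp [hk])) (fun k hk => hl' k (by simp [hk])) h3
      simp only [List.cons.injEq, and_true]
      omega

theorem exists_partialSums (V : Finset ℕ) (hV : 0 ∉ V) :
    ∃ l : List ℕ, (∀ i ∈ l, 0 < i) ∧ partialSums l = V := by
  induction V using Finset.induction_on_max with
  | empty => exact ⟨[], by simp, rfl⟩
  | insert a s hs ih =>
    simp only [Finset.mem_insert, not_or] at hV
    obtain ⟨l, hl, rfl⟩ := ih hV.2
    have hlt : l.sum < a := by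
      rw [← sup_partialSums]
      -- For an empty remainder the supremum is 0, so the inequality needs a ≠ 0.
      exact (Finset.sup_lt_iff (by simp; omega)).2 hs
    refine ⟨(a - l.sum) :: l, ?_, ?_⟩
    · simp only [List.mem_cons, forall_eq_or_imp]
      exact ⟨by omega, hl⟩
    · rw [partialSums, Nat.sub_add_cancel hlt.le]

/-! ### Periodic noncrossing systems of arcs on the integers -/

/-- An `M`-periodic system of pairwise noncrossing arcs `(a, b)` with `2 ≤ b - a ≤ M`. -/
structure IsArcSystem (M : ℕ) (A : ℤ → ℤ → Prop) : Prop where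
  add_two_le : ∀ {a b}, A a b → a + 2 ≤ b
  le_add : ∀ {a b}, A a b → b ≤ a + M
  periodic : ∀ a b, A (a + M) (b + M) ↔ A a b
  noncrossing : ∀ {a b c d}, A a b → A c d → a < c → c < b → b < d → False

/-- `(a, b)` is the smallest arc lying strictly above the point `c`. -/
def Parent (A : ℤ → ℤ → Prop) (c a b : ℤ) : Prop :=
  A a b ∧ a < c ∧ c < b ∧ ∀ a' b', A a' b' → a' < c → c < b' → a' ≤ a ∧ b ≤ b'

/-- The smallest arc lying strictly above the point `c` starts at `a`. -/
def Under (A : ℤ → ℤ → Prop) (c a : ℤ) : Prop := ∃ b, Parent A c a b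

open Classical in
/-- The number of points of the open interval `(a, b)` whose parent starts at `a`. -/
noncomputable def reach (A : ℤ → ℤ → Prop) (a b : ℤ) : ℕ :=
  ((Finset.Ioo a b).filter fun c => Under A c a).card

open Classical in
/-- The number of points whose parent is `(a, b)`. -/
noncomputable def cellSize (A : ℤ → ℤ → Prop) (a b : ℤ) : ℕ :=
  ((Finset.Ioo a b).filter fun c => Parent A c a b).card

open Classical in
/-- The right endpoints of the arcs starting at `a`. -/
noncomputable def arcEnds (M : ℕ) (A : ℤ → ℤ → Prop) (a : ℤ) : Finset ℤ :=
  (Finset.Ioc a (a + M)).filter fun b => A a b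

/-- The code of an arc system: the values of `reach` on the arcs starting at `a`. -/
noncomputable def code (M : ℕ) (A : ℤ → ℤ → Prop) (a : ℤ) : Finset ℕ :=
  (arcEnds M A a).image (reach A a)

/-- The first return `b` after `a` of the path with up-steps `W` and unit down-steps, started at
height `R`. -/
def IsReturn (W : ℤ → ℕ) (a : ℤ) (R : ℕ) (b : ℤ) : Prop :=
  a < b ∧ (R : ℤ) + ∑ k ∈ Finset.Ioo a b, (W k : ℤ) ≤ b - a - 1 ∧
    ∀ x, a < x → x < b → x - a - 1 < (R : ℤ) + ∑ k ∈ Finset.Ioo a x, (W k : ℤ)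

/-- The weight of a code at a point. -/
def weight (V : ℤ → Finset ℕ) (k : ℤ) : ℕ := (V k).sup id

/-- The arcs described by a code. -/
def arcsOf (V : ℤ → Finset ℕ) (a b : ℤ) : Prop := ∃ R ∈ V a, IsReturn (weight V) a R b

theorem sum_Ioo_split {a x b : ℤ} (hax : a < x) (hxb : x ≤ b) (f : ℤ → ℤ) :
    ∑ k ∈ Finset.Ioo a b, f k = ∑ k ∈ Finset.Ioo a x, f k + ∑ k ∈ Finset.Ico x b, f k := by
  rw [← Finset.sum_union]
  · congr 1
    ext k
    simp only [Finset.mem_union, Finset.mem_Ioo, Finset.mem_Ico]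
    omega
  · rw [Finset.disjoint_left]
    intro k
    simp only [Finset.mem_Ioo, Finset.mem_Ico]
    omega

theorem IsReturn.unique {W : ℤ → ℕ} {a : ℤ} {R : ℕ} {b b' : ℤ} (h : IsReturn W a R b)
    (h' : IsReturn W a R b') : b = b' := by
  rcases lt_trichotomy b b' with hlt | rfl | hlt
  · have := h'.2.2 b h.1 hlt
    have := h.2.1
    omega
  · rfl
  · have := h.2.2 b' h'.1 hlt
    have := h'.2.1
    omega

theorem Parent.unique {A : ℤ → ℤ → Prop} {c a b a' b' : ℤ} (h : Parent A c a b)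
    (h' : Parent A c a' b') : a = a' ∧ b = b' := by
  have h1 := h.2.2.2 _ _ h'.1 h'.2.1 h'.2.2.1
  have h2 := h'.2.2.2 _ _ h.1 h.2.1 h.2.2.1
  omega

theorem Under.unique {A : ℤ → ℤ → Prop} {c a a' : ℤ} (h : Under A c a) (h' : Under A c a') :
    a = a' := by
  obtain ⟨b, hb⟩ := h
  obtain ⟨b', hb'⟩ := h'
  exact (hb.unique hb').1

theorem Under.lt {A : ℤ → ℤ → Prop} {c a : ℤ} (h : Under A c a) : a < c := by
  obtain ⟨b, hb⟩ := h
  exact hb.2.1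

theorem reach_mono (A : ℤ → ℤ → Prop) {a b b' : ℤ} (h : b ≤ b') : reach A a b ≤ reach A a b' := by
  classical
  unfold reach
  gcongr

open Classical in
-- A point has at most one parent, so the sets counted for different k are disjoint.
theorem sum_reach (A : ℤ → ℤ → Prop) (x y : ℤ) : ∑ k ∈ Finset.Ico x y, reach A k y =
    ((Finset.Ioo x y).filter fun c => ∃ k, x ≤ k ∧ Under A c k).card := by
  unfold reach
  rw [← Finset.card_biUnion]
  · congr 1
    ext c
    simp only [Finset.mem_biUnion, Finset.mem_filter, Finset.mem_Ioo, Finset.mem_Ico]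
    constructor
    · rintro ⟨k, hk, hc, hu⟩
      exact ⟨by omega, k, hk.1, hu⟩
    · rintro ⟨hc, k, hk, hu⟩
      have := hu.lt
      exact ⟨k, by omega, by omega, hu⟩
  · intro k _ k' _ hkk'
    rw [Function.onFun, Finset.disjoint_left]
    intro c h1 h2
    exact hkk' ((Finset.mem_filter.1 h1).2.unique (Finset.mem_filter.1 h2).2)

theorem sum_reach_le (A : ℤ → ℤ → Prop) {x y : ℤ} (h : x < y) :
    (∑ k ∈ Finset.Ico x y, (reach A k y : ℤ)) ≤ y - x - 1 := by
  classical
  rw [← Nat.cast_sum, sum_reach]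
  have := Finset.card_filter_le (Finset.Ioo x y) fun c => ∃ k, x ≤ k ∧ Under A c k
  rw [Int.card_Ioo] at this
  omega

/-! ### An arc system is determined by its code -/

namespace IsArcSystem

variable {M : ℕ} {A : ℤ → ℤ → Prop} (hA : IsArcSystem M A)
include hA

theorem lt {a b : ℤ} (h : A a b) : a < b := by have := hA.add_two_le h; omega

theorem mem_arcEnds {a b : ℤ} : b ∈ arcEnds M A a ↔ A a b := by
  simp only [arcEnds, Finset.mem_filter, Finset.mem_Ioc]
  exact ⟨fun h => h.2, fun h => ⟨⟨hA.lt h, hA.le_add h⟩, h⟩⟩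

/-- Take the rightmost start of an arc above c, then its nearest end; noncrossing makes this the
smallest arc. The length bound M confines the search to finite windows. -/
theorem exists_parent {c a₀ b₀ : ℤ} (h : A a₀ b₀) (hac : a₀ < c) (hcb : c < b₀) :
    ∃ a b, Parent A c a b := by
  classical
  have hS : ((Finset.Ico (c - M) c).filter fun k => ∃ b, c < b ∧ A k b).Nonempty :=
    ⟨a₀, by
      have := hA.le_add h
      simp only [Finset.mem_filter, Finset.mem_Ico]
      exact ⟨by omega, b₀, hcb, h⟩⟩
  obtain ⟨a, ha, hmax⟩ := Finset.exists_max_image _ id hS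
  simp only [Finset.mem_filter, Finset.mem_Ico, id] at ha hmax
  obtain ⟨hac', b₁, hb₁, hab₁⟩ := ha
  have hT : ((Finset.Ioc a (a + M)).filter fun b => c < b ∧ A a b).Nonempty :=
    ⟨b₁, by
      have := hA.le_add hab₁
      simp only [Finset.mem_filter, Finset.mem_Ioc]
      exact ⟨by omega, hb₁, hab₁⟩⟩
  obtain ⟨b, hb, hmin⟩ := Finset.exists_min_image _ id hT
  simp only [Finset.mem_filter, Finset.mem_Ioc, id] at hb hmin
  refine ⟨a, b, hb.2.2, hac'.2, hb.2.1, fun a' b' h' ha' hb' => ?_⟩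
  have hle := hA.le_add h'
  have h1 : a' ≤ a := hmax a' ⟨by omega, b', hb', h'⟩
  refine ⟨h1, ?_⟩
  rcases h1.lt_or_eq with h1 | rfl
  · by_contra hlt
    exact hA.noncrossing h' hb.2.2 h1 (by omega) (by omega)
  · exact hmin b' ⟨by omega, hb', h'⟩

theorem reach_eq_weight {a y : ℤ} (hy : ∀ b, A a b → b ≤ y) : reach A a y = weight (code M A) a := by
  classical
  apply le_antisymm
  · rcases (arcEnds M A a).eq_empty_or_nonempty with he | hne
    · rw [reach, Finset.filter_false_of_mem]
      · simp
      · rintro c - ⟨b, hb⟩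
        have := hA.mem_arcEnds.2 hb.1
        simp [he] at this
    · obtain ⟨b, hb, hmax⟩ := Finset.exists_max_image _ id hne
      have hle : reach A a b ≤ weight (code M A) a :=
        Finset.le_sup (f := id) (Finset.mem_image_of_mem (reach A a) hb)
      refine le_trans (Finset.card_le_card ?_) hle
      intro c
      simp only [Finset.mem_filter, Finset.mem_Ioo]
      rintro ⟨-, b', hb'⟩
      have h1 : b' ≤ b := hmax b' (hA.mem_arcEnds.2 hb'.1)
      have := hb'.2.2.1
      exact ⟨⟨hb'.2.1, by omega⟩, b', hb'⟩
  · refine Finset.sup_le fun R hR => ?_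
    obtain ⟨b, hb, rfl⟩ := Finset.mem_image.1 hR
    exact reach_mono A (hy b (hA.mem_arcEnds.1 hb))

theorem le_of_start {a b k d : ℤ} (h : A a b) (hk : A k d) (h1 : a < k) (h2 : k < b) : d ≤ b := by
  by_contra hlt
  exact hA.noncrossing h hk h1 h2 (by omega)

/-- Sort the b - a - 1 interior points by the start of their parent, which lies in [a, b). Arcs
starting strictly inside end by b, so each interior start contributes its full weight. -/
theorem reach_add_sum {a b : ℤ} (h : A a b) :
    (reach A a b : ℤ) + ∑ k ∈ Finset.Ioo a b, (weight (code M A) k : ℤ) = b - a - 1 := by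
  classical
  have hs := sum_reach A a b
  rw [Finset.filter_true_of_mem, Int.card_Ioo, ← Finset.Ioo_insert_left (hA.lt h),
    Finset.sum_insert (by simp)] at hs
  · have hw : ∀ k ∈ Finset.Ioo a b, weight (code M A) k = reach A k b := fun k hk => by
      have := Finset.mem_Ioo.1 hk
      rw [hA.reach_eq_weight fun d hd => hA.le_of_start h hd this.1 this.2]
    rw [← Nat.cast_sum, Finset.sum_congr rfl hw]
    have := hA.lt h
    omega
  · intro c hc
    rw [Finset.mem_Ioo] at hc
    obtain ⟨a', b', hp⟩ := hA.exists_parent h hc.1 hc.2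
    exact ⟨a', (hp.2.2.2 _ _ h hc.1 hc.2).1, b', hp⟩

theorem sum_weight_le {a b x : ℤ} (h : A a b) (hax : a < x) (hxb : x < b) :
    ∑ k ∈ Finset.Ico x b, (weight (code M A) k : ℤ) ≤ b - x - 1 := by
  refine le_trans (le_of_eq (Finset.sum_congr rfl fun k hk => ?_)) (sum_reach_le A hxb)
  have := Finset.mem_Ico.1 hk
  rw [hA.reach_eq_weight fun d hd => hA.le_of_start h hd (by omega) this.2]

/-- The path is at level zero at b by `reach_add_sum`. It is above zero at an earlier x, since the
starts in [x, b) account for at most the b - x - 1 points of (x, b). -/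
theorem isReturn {a b : ℤ} (h : A a b) : IsReturn (weight (code M A)) a (reach A a b) b := by
  have h1 := hA.reach_add_sum h
  refine ⟨hA.lt h, h1.le, fun x hax hxb => ?_⟩
  have h2 := hA.sum_weight_le h hax hxb
  rw [sum_Ioo_split hax hxb.le] at h1
  omega

theorem arcsOf_code : arcsOf (code M A) = A := by
  ext a b
  constructor
  · rintro ⟨R, hR, hret⟩
    obtain ⟨b', hb', rfl⟩ := Finset.mem_image.1 hR
    have hb' := hA.mem_arcEnds.1 hb'
    rwa [hret.unique (hA.isReturn hb')]
  · intro h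
    exact ⟨_, Finset.mem_image_of_mem _ (hA.mem_arcEnds.2 h), hA.isReturn h⟩

theorem reach_lt {a b b' : ℤ} (h : A a b) (h' : A a b') (hlt : b < b') :
    reach A a b < reach A a b' := by
  have h1 := hA.reach_add_sum h
  have h2 := (hA.isReturn h').2.2 b (hA.lt h) hlt
  omega

theorem reach_pos {a b : ℤ} (h : A a b) : 0 < reach A a b := by
  have h2 := (hA.isReturn h).2.2 (a + 1) (by omega) (by have := hA.add_two_le h; omega)
  rw [show Finset.Ioo a (a + 1) = ∅ by ext; simp] at h2
  simp at h2
  omega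

theorem zero_notMem_code (a : ℤ) : 0 ∉ code M A a := by
  intro h
  obtain ⟨b, hb, h0⟩ := Finset.mem_image.1 h
  exact (hA.reach_pos (hA.mem_arcEnds.1 hb)).ne' h0

theorem reach_injOn (a : ℤ) : Set.InjOn (reach A a) (arcEnds M A a) := by
  intro b hb b' hb' h
  have hb := hA.mem_arcEnds.1 hb
  have hb' := hA.mem_arcEnds.1 hb'
  rcases lt_trichotomy b b' with hlt | rfl | hlt
  · exact absurd h (hA.reach_lt hb hb' hlt).ne
  · rfl
  · exact absurd h (hA.reach_lt hb' hb hlt).ne'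

/-- Compare with the next shorter arc (a, d): a point of (a, b) whose parent starts at a either has
parent (a, b) or is already counted below (a, d). If there is no shorter arc, the supremum is that
of the empty set, 0. -/
theorem reach_eq_cellSize_add {a b : ℤ} (h : A a b) : reach A a b =
    cellSize A a b + ((code M A a).filter (· < reach A a b)).sup id := by
  classical
  rcases ((arcEnds M A a).filter (· < b)).eq_empty_or_nonempty with he | hne
  · have h1 : (code M A a).filter (· < reach A a b) = ∅ := by
      refine Finset.filter_false_of_mem fun R hR => ?_
      obtain ⟨d, hd, rfl⟩ := Finset.mem_image.1 hR
      have h3 : ¬ d < b := Finset.filter_eq_empty_iff.1 he hd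
      exact not_lt.2 (reach_mono A (not_lt.1 h3))
    rw [h1, Finset.sup_empty, bot_eq_zero, add_zero, reach, cellSize]
    congr 1
    refine Finset.filter_congr fun c hc => ⟨?_, fun hp => ⟨b, hp⟩⟩
    rintro ⟨d, hd⟩
    have hle := (hd.2.2.2 a b h (Finset.mem_Ioo.1 hc).1 (Finset.mem_Ioo.1 hc).2).2
    have h3 : ¬ d < b := Finset.filter_eq_empty_iff.1 he (hA.mem_arcEnds.2 hd.1)
    obtain rfl : d = b := by omega
    exact hd
  · obtain ⟨d, hd, hmax⟩ := Finset.exists_max_image _ id hne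
    simp only [Finset.mem_filter, hA.mem_arcEnds, id] at hd hmax
    have h1 : ((code M A a).filter (· < reach A a b)).sup id = reach A a d := by
      apply le_antisymm
      · refine Finset.sup_le fun R hR => ?_
        obtain ⟨hR, hlt⟩ := Finset.mem_filter.1 hR
        obtain ⟨x, hx, rfl⟩ := Finset.mem_image.1 hR
        refine reach_mono A (hmax x ⟨hA.mem_arcEnds.1 hx, ?_⟩)
        by_contra hxb
        exact absurd (reach_mono A (not_lt.1 hxb)) (not_le.2 hlt)
      · exact Finset.le_sup (f := id) (Finset.mem_filter.2
          ⟨Finset.mem_image_of_mem _ (hA.mem_arcEnds.2 hd.1), hA.reach_lt hd.1 h hd.2⟩)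
    rw [h1, reach, cellSize, reach, ← Finset.card_union_of_disjoint]
    · congr 1
      ext c
      simp only [Finset.mem_union, Finset.mem_filter, Finset.mem_Ioo]
      constructor
      · rintro ⟨hc, x, hx⟩
        rcases (hx.2.2.2 a b h hc.1 hc.2).2.eq_or_lt with rfl | hlt
        · exact Or.inl ⟨hc, hx⟩
        · have := hmax x ⟨hx.1, hlt⟩
          have := hx.2.2.1
          exact Or.inr ⟨by omega, x, hx⟩
      · rintro (⟨hc, hp⟩ | ⟨hc, hu⟩)
        · exact ⟨hc, b, hp⟩
        · exact ⟨by omega, hu⟩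
    · rw [Finset.disjoint_left]
      intro c h2 h3
      simp only [Finset.mem_filter, Finset.mem_Ioo] at h2 h3
      have := (h2.2.2.2.2 a d hd.1 h3.1.1 h3.1.2).2
      omega

/-- This is how a code records subpolygons: its gaps at a are the cell sizes of the arcs starting
there, with multiplicity. -/
theorem gaps_code (a : ℤ) : gaps (code M A a) = (arcEnds M A a).val.map (cellSize A a) := by
  rw [gaps, code, Finset.image_val_of_injOn (hA.reach_injOn a), Multiset.map_map]
  refine Multiset.map_congr rfl fun b hb => ?_
  have := hA.reach_eq_cellSize_add (hA.mem_arcEnds.1 (Finset.mem_def.2 hb))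
  rw [code] at this
  simp only [Function.comp]
  omega

theorem cellSize_pos {a b : ℤ} (h : A a b) : 0 < cellSize A a b := by
  have h1 := hA.reach_eq_cellSize_add h
  have h2 : ((code M A a).filter (· < reach A a b)).sup id < reach A a b :=
    (Finset.sup_lt_iff (hA.reach_pos h)).2 fun R hR => (Finset.mem_filter.1 hR).2
  omega

end IsArcSystem

/-! ### Translations -/

theorem periodic_parent {A : ℤ → ℤ → Prop} {k : ℤ} (hk : ∀ a b, A (a + k) (b + k) ↔ A a b)
    (c a b : ℤ) : Parent A (c + k) (a + k) (b + k) ↔ Parent A c a b := by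
  unfold Parent
  rw [hk]
  refine and_congr Iff.rfl (and_congr (by omega) (and_congr (by omega) ⟨fun h a' b' h' ha hb => ?_,
    fun h a' b' h' ha hb => ?_⟩))
  · have := h _ _ ((hk a' b').2 h') (by omega) (by omega)
    omega
  · have := h (a' - k) (b' - k) ((hk _ _).1 (by simpa using h')) (by omega) (by omega)
    omega

theorem periodic_under {A : ℤ → ℤ → Prop} {k : ℤ} (hk : ∀ a b, A (a + k) (b + k) ↔ A a b)
    (c a : ℤ) : Under A (c + k) (a + k) ↔ Under A c a := by
  constructor
  · rintro ⟨b, hb⟩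
    exact ⟨b - k, (periodic_parent hk _ _ _).1 (by simpa using hb)⟩
  · rintro ⟨b, hb⟩
    exact ⟨b + k, (periodic_parent hk _ _ _).2 hb⟩

theorem card_filter_Ioo_add (p : ℤ → Prop) [DecidablePred p] (q : ℤ → Prop) [DecidablePred q]
    (a b k : ℤ) (h : ∀ c, p (c + k) ↔ q c) :
    ((Finset.Ioo (a + k) (b + k)).filter p).card = ((Finset.Ioo a b).filter q).card := by
  refine Finset.card_nbij' (· - k) (· + k) ?_ ?_ (fun c _ => by simp) (fun c _ => by simp)
  · intro c hc
    simp only [Finset.coe_filter, Finset.mem_Ioo, Set.mem_ofPred_eq] at hc ⊢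
    refine ⟨by omega, (h _).1 (by simpa using hc.2)⟩
  · intro c hc
    simp only [Finset.coe_filter, Finset.mem_Ioo, Set.mem_ofPred_eq] at hc ⊢
    exact ⟨by omega, (h _).2 hc.2⟩

theorem periodic_reach {A : ℤ → ℤ → Prop} {k : ℤ} (hk : ∀ a b, A (a + k) (b + k) ↔ A a b)
    (a b : ℤ) : reach A (a + k) (b + k) = reach A a b := by
  classical
  exact card_filter_Ioo_add _ _ _ _ _ fun c => periodic_under hk c a

theorem periodic_cellSize {A : ℤ → ℤ → Prop} {k : ℤ} (hk : ∀ a b, A (a + k) (b + k) ↔ A a b)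
    (a b : ℤ) : cellSize A (a + k) (b + k) = cellSize A a b := by
  classical
  exact card_filter_Ioo_add _ _ _ _ _ fun c => periodic_parent hk c a b

theorem IsArcSystem.periodic_code {M : ℕ} {A : ℤ → ℤ → Prop} (hA : IsArcSystem M A) {k : ℤ}
    (hk : ∀ a b, A (a + k) (b + k) ↔ A a b) (a : ℤ) : code M A (a + k) = code M A a := by
  ext R
  simp only [code, Finset.mem_image, hA.mem_arcEnds]
  constructor
  · rintro ⟨b, hb, rfl⟩
    refine ⟨b - k, (hk _ _).1 (by simpa using hb), ?_⟩
    rw [← periodic_reach hk, sub_add_cancel]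
  · rintro ⟨b, hb, rfl⟩
    exact ⟨b + k, (hk _ _).2 hb, periodic_reach hk _ _⟩

theorem sum_Ioo_add (f g : ℤ → ℤ) (a b k : ℤ) (h : ∀ c, f (c + k) = g c) :
    ∑ c ∈ Finset.Ioo (a + k) (b + k), f c = ∑ c ∈ Finset.Ioo a b, g c := by
  refine Finset.sum_nbij' (· - k) (· + k) ?_ ?_ (fun c _ => by simp) (fun c _ => by simp)
    (fun c _ => by rw [← h, sub_add_cancel])
  · intro c hc
    simp only [Finset.mem_Ioo] at hc ⊢
    omega
  · intro c hc
    simp only [Finset.mem_Ioo] at hc ⊢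
    omega

theorem IsReturn.add {W W' : ℤ → ℕ} {a k : ℤ} {R : ℕ} {b : ℤ} (hk : ∀ c, W' (c + k) = W c)
    (h : IsReturn W a R b) : IsReturn W' (a + k) R (b + k) := by
  have hs : ∀ x, ∑ c ∈ Finset.Ioo (a + k) (x + k), (W' c : ℤ) = ∑ c ∈ Finset.Ioo a x, (W c : ℤ) :=
    fun x => sum_Ioo_add _ _ _ _ _ fun c => by rw [hk]
  refine ⟨by have := h.1; omega, ?_, fun x hx hxb => ?_⟩
  · rw [hs]
    have := h.2.1
    omega
  · have h1 := h.2.2 (x - k) (by omega) (by omega)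
    rw [← hs, sub_add_cancel] at h1
    omega

theorem arcsOf_add {V V' : ℤ → Finset ℕ} {k : ℤ} (hk : ∀ a, V' (a + k) = V a) (a b : ℤ) :
    arcsOf V' (a + k) (b + k) ↔ arcsOf V a b := by
  have hw : ∀ c, weight V' (c + k) = weight V c := fun c => by rw [weight, weight, hk]
  have hw' : ∀ c, weight V (c + -k) = weight V' c := fun c => by rw [← hw, neg_add_cancel_right]
  constructor
  · rintro ⟨R, hR, h⟩
    refine ⟨R, by rwa [hk] at hR, ?_⟩
    simpa using h.add hw'
  · rintro ⟨R, hR, h⟩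
    exact ⟨R, by rwa [hk], h.add hw⟩

/-! ### The arc system described by a code -/

theorem le_weight {V : ℤ → Finset ℕ} {a : ℤ} {R : ℕ} (hR : R ∈ V a) : R ≤ weight V a :=
  Finset.le_sup (f := id) hR

/-- A family of finite sets of positive integers of total weight less than `M` per period. -/
structure IsCode (M : ℕ) (V : ℤ → Finset ℕ) : Prop where
  periodic : ∀ a, V (a + M) = V a
  zero_notMem : ∀ a, 0 ∉ V a
  sum_lt : ∀ a : ℤ, ∑ k ∈ Finset.Ico a (a + M), (weight V k : ℤ) < M

namespace IsCode

variable {M : ℕ} {V : ℤ → Finset ℕ} (hV : IsCode M V)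
include hV

theorem pos {a : ℤ} {R : ℕ} (hR : R ∈ V a) : 0 < R :=
  Nat.pos_of_ne_zero fun h => hV.zero_notMem a (h ▸ hR)

/-- One period has M unit down-steps and total up-step less than M, so the path has returned by a +
M. -/
theorem return_bound {a : ℤ} {R : ℕ} (hR : R ∈ V a) :
    (R : ℤ) + ∑ k ∈ Finset.Ioo a (a + M), (weight V k : ℤ) ≤ M - 1 := by
  have h := hV.sum_lt a
  have hM : (0 : ℤ) < M := (Finset.sum_nonneg fun _ _ => by positivity).trans_lt h
  rw [← Finset.Ioo_insert_left (by omega), Finset.sum_insert (by simp)] at h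
  have := le_weight hR
  omega

theorem exists_isReturn {a : ℤ} {R : ℕ} (hR : R ∈ V a) : ∃ b, IsReturn (weight V) a R b := by
  classical
  have hb := hV.return_bound hR
  have hM : 0 < M := by
    have := hV.pos hR
    have : 0 ≤ ∑ k ∈ Finset.Ioo a (a + M), (weight V k : ℤ) :=
      Finset.sum_nonneg fun _ _ => by positivity
    omega
  have hex : ∃ n : ℕ, (R : ℤ) + ∑ k ∈ Finset.Ioo a (a + 1 + n), (weight V k : ℤ) ≤ n :=
    ⟨M - 1, by
      rw [show a + 1 + ((M - 1 : ℕ) : ℤ) = a + M by omega]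
      omega⟩
  refine ⟨a + 1 + Nat.find hex, by omega, by have := Nat.find_spec hex; omega, fun x hx hxb => ?_⟩
  have := Nat.find_min hex (m := (x - a - 1).toNat) (by omega)
  rw [show a + 1 + ((x - a - 1).toNat : ℤ) = x by omega] at this
  omega

/-- Down-steps have size one, so the path cannot jump below level zero at its first return. -/
theorem isReturn_eq {a b : ℤ} {R : ℕ} (hR : R ∈ V a) (h : IsReturn (weight V) a R b) :
    (R : ℤ) + ∑ k ∈ Finset.Ioo a b, (weight V k : ℤ) = b - a - 1 := by
  have hR0 := hV.pos hR
  have h1 := h.2.1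
  have h0 := h.1
  have hpos : 0 ≤ ∑ k ∈ Finset.Ioo a b, (weight V k : ℤ) :=
    Finset.sum_nonneg fun _ _ => by positivity
  rcases (show a ≤ b - 1 by omega).eq_or_lt with he | hlt
  · omega
  · have h2 := h.2.2 (b - 1) hlt (by omega)
    rw [sum_Ioo_split (x := b - 1) hlt (by omega)] at h1 ⊢
    have : 0 ≤ ∑ k ∈ Finset.Ico (b - 1) b, (weight V k : ℤ) :=
      Finset.sum_nonneg fun _ _ => by positivity
    omega

theorem isArcSystem : IsArcSystem M (arcsOf V) where
  add_two_le := by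
    rintro a b ⟨R, hR, h⟩
    have h1 := hV.isReturn_eq hR h
    have h2 := hV.pos hR
    have hpos : 0 ≤ ∑ k ∈ Finset.Ioo a b, (weight V k : ℤ) :=
      Finset.sum_nonneg fun _ _ => by positivity
    omega
  le_add := by
    rintro a b ⟨R, hR, h⟩
    have h1 := hV.return_bound hR
    by_contra hlt
    have h0 : (0 : ℤ) < M := (Finset.sum_nonneg fun _ _ => by positivity).trans_lt (hV.sum_lt a)
    have := h.2.2 (a + M) (by omega) (by omega)
    omega
  periodic := arcsOf_add hV.periodic
  noncrossing := by
    rintro a b c d ⟨R, hR, h⟩ ⟨R', hR', h'⟩ hac hcb hbd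
    have h1 := h'.2.2 b hcb hbd
    -- The path of (a, b) is above zero at c and rises there by at least R'; the path of (c, d) from
    -- height R' is above zero at b. Added up, the first path is still above zero at b.
    have h2 := h.2.2 c hac hcb
    have h3 := h.2.1
    have h4 := le_weight hR'
    rw [sum_Ioo_split hac hcb.le, ← Finset.Ioo_insert_left hcb, Finset.sum_insert (by simp)] at h3
    omega

/-- Induction on the length of the arc: inside (a, b) the arcs are shorter, so there the code of the
arc system agrees with V. Then `reach_add_sum` and `isReturn_eq` are the same balance, solved by
`reach` and by R. -/
theorem reach_arcsOf {a b : ℤ} {R : ℕ} (hR : R ∈ V a) (h : IsReturn (weight V) a R b) :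
    reach (arcsOf V) a b = R := by
  have hA := hV.isArcSystem
  suffices H : ∀ n : ℕ, ∀ a b R, R ∈ V a → IsReturn (weight V) a R b → b - a ≤ n →
      reach (arcsOf V) a b = R from H (b - a).toNat a b R hR h (by omega)
  intro n
  induction n with
  | zero => intro a b R _ h _; have := h.1; omega
  | succ n ih =>
    intro a b R hR h hn
    have hab : arcsOf V a b := ⟨R, hR, h⟩
    have h1 := hA.reach_add_sum hab
    have h2 := hV.isReturn_eq hR h
    have hw : ∀ k ∈ Finset.Ioo a b, weight (code M (arcsOf V)) k = weight V k := by
      intro k hk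
      have hk := Finset.mem_Ioo.1 hk
      rw [weight, weight]
      congr 1
      ext R'
      simp only [code, Finset.mem_image, hA.mem_arcEnds]
      constructor
      · rintro ⟨d, ⟨R'', hR'', hd⟩, rfl⟩
        have := hA.le_of_start hab ⟨R'', hR'', hd⟩ hk.1 hk.2
        rwa [ih k d R'' hR'' hd (by omega)]
      · intro hR'
        obtain ⟨d, hd⟩ := hV.exists_isReturn hR'
        have := hA.le_of_start hab ⟨R', hR', hd⟩ hk.1 hk.2
        exact ⟨d, ⟨R', hR', hd⟩, ih k d R' hR' hd (by omega)⟩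
    rw [Finset.sum_congr rfl fun k hk => by rw [hw k hk]] at h1
    omega

theorem code_arcsOf : code M (arcsOf V) = V := by
  funext k
  have hA := hV.isArcSystem
  ext R
  simp only [code, Finset.mem_image, hA.mem_arcEnds]
  constructor
  · rintro ⟨d, ⟨R', hR', hd⟩, rfl⟩
    rwa [hV.reach_arcsOf hR' hd]
  · intro hR
    obtain ⟨d, hd⟩ := hV.exists_isReturn hR
    exact ⟨d, ⟨R, hR, hd⟩, hV.reach_arcsOf hR hd⟩

end IsCode

/-! ### Counting covered points -/

theorem sum_Ico_add {R : Type*} [AddCommMonoid R] (f : ℤ → R) (a b k : ℤ) :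
    ∑ c ∈ Finset.Ico (a + k) (b + k), f c = ∑ c ∈ Finset.Ico a b, f (c + k) := by
  refine Finset.sum_nbij' (· - k) (· + k) ?_ ?_ (fun c _ => by simp) (fun c _ => by simp)
    (fun c _ => by rw [sub_add_cancel])
  · intro c hc
    simp only [Finset.mem_Ico] at hc ⊢
    omega
  · intro c hc
    simp only [Finset.mem_Ico] at hc ⊢
    omega

theorem sum_Ico_split {R : Type*} [AddCommMonoid R] {a x b : ℤ} (hax : a ≤ x) (hxb : x ≤ b)
    (f : ℤ → R) :
    ∑ k ∈ Finset.Ico a b, f k = ∑ k ∈ Finset.Ico a x, f k + ∑ k ∈ Finset.Ico x b, f k := by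
  rw [← Finset.sum_union (Finset.Ico_disjoint_Ico_consecutive a x b),
    Finset.Ico_union_Ico_eq_Ico hax hxb]

open Classical in
-- Double count the pairs (point, start of its parent) modulo M, normalising the point on one side
-- and the start on the other.
theorem IsArcSystem.card_covered {M : ℕ} {A : ℤ → ℤ → Prop} (hA : IsArcSystem M A) :
    ((Finset.Ico (0 : ℤ) M).filter fun c => ∃ a, Under A c a).card =
      ∑ a ∈ Finset.Ico (0 : ℤ) M, weight (code M A) a := by
  have hper := periodic_under hA.periodic
  have h1 : ∀ c ∈ Finset.Ico (0 : ℤ) M, (if ∃ a, Under A c a then 1 else 0) =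
      ∑ a ∈ Finset.Ico (-M : ℤ) M, if Under A c a then 1 else 0 := by
    intro c hc
    rw [Finset.mem_Ico] at hc
    split_ifs with h
    · obtain ⟨a, ha⟩ := h
      rw [Finset.sum_eq_single a, if_pos ha]
      · intro b _ hb
        rw [if_neg fun h => hb (h.unique ha)]
      · intro h
        obtain ⟨b, hb⟩ := ha
        have := hA.le_add hb.1
        have := hb.2
        rw [Finset.mem_Ico] at h
        omega
    · rw [Finset.sum_eq_zero]
      intro a _
      rw [if_neg fun h' => h ⟨a, h'⟩]
  have h2 : ∀ a ∈ Finset.Ico (0 : ℤ) M, weight (code M A) a =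
      ∑ c ∈ Finset.Ico (0 : ℤ) (M + M), if Under A c a then 1 else 0 := by
    intro a ha
    rw [Finset.mem_Ico] at ha
    rw [← hA.reach_eq_weight (y := a + M) fun b hb => hA.le_add hb, reach, Finset.card_filter]
    refine Finset.sum_subset_zero_on_sdiff ?_ ?_ fun _ _ => rfl
    · intro c hc
      rw [Finset.mem_Ioo] at hc
      rw [Finset.mem_Ico]
      omega
    · intro c hc
      rw [Finset.mem_sdiff, Finset.mem_Ioo] at hc
      rw [if_neg]
      rintro ⟨b, hb⟩
      have := hA.le_add hb.1
      exact hc.2 ⟨hb.2.1, by have := hb.2.2.1; omega⟩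
  rw [Finset.card_filter, Finset.sum_congr rfl h1, Finset.sum_congr rfl h2]
  -- Pairs with both entries in [0, M) agree. Those with start in [-M, 0) match those with point in
  -- [M, 2M) by translation by M.
  rw [Finset.sum_congr rfl fun c _ => sum_Ico_split (x := 0) (by omega) (by omega) _,
    Finset.sum_congr rfl fun a _ => sum_Ico_split (b := M + M) (x := M) (by omega) (by omega) _,
    Finset.sum_add_distrib, Finset.sum_add_distrib, add_comm]
  congr 1
  · exact Finset.sum_comm
  · rw [Finset.sum_comm]
    have e2 : ∀ a, ∑ c ∈ Finset.Ico (M : ℤ) (M + M), (if Under A c a then 1 else 0) =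
        ∑ c ∈ Finset.Ico (0 : ℤ) M, if Under A (c + M) a then 1 else 0 := fun a => by
      have := sum_Ico_add (fun c => if Under A c a then 1 else 0) 0 M M
      rwa [zero_add] at this
    simp_rw [e2]
    have e1 := sum_Ico_add (fun a => ∑ c ∈ Finset.Ico (0 : ℤ) M, if Under A (c + M) a then 1 else 0)
      (-M) 0 M
    rw [neg_add_cancel, zero_add] at e1
    rw [e1]
    simp_rw [hper]

/-! ### Dissections and arc systems -/

section Lifts

variable {N : ℕ}

theorem intCast_eq_of_window {a x y : ℤ} (h1 : a ≤ x) (h2 : x < a + N) (h3 : a ≤ y)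
    (h4 : y < a + N) : (x : ZMod N) = y ↔ x = y := by
  refine ⟨fun h => ?_, fun h => by rw [h]⟩
  rw [ZMod.intCast_eq_intCast_iff_dvd_sub] at h
  have := Int.eq_zero_of_abs_lt_dvd h (by rw [abs_lt]; omega)
  omega

theorem intCast_add_self (x : ℤ) : ((x + N : ℤ) : ZMod N) = x := by simp

theorem vadd_pair (g x y : ZMod N) :
    g +ᵥ ({x, y} : Finset (ZMod N)) = {x + g, y + g} := by
  rw [Finset.vadd_finset_def, Finset.image_insert, Finset.image_singleton]
  simp only [vadd_eq_add, add_comm]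

theorem pair_eq_pair {α : Type*} [DecidableEq α] {x y z w : α} :
    ({x, y} : Finset α) = {z, w} ↔ x = z ∧ y = w ∨ x = w ∧ y = z := by
  rw [← Finset.coe_inj]
  push_cast
  exact Set.pair_eq_pair_iff

theorem isSide_intCast {a b : ℤ} (h1 : a < b) (h2 : b < a + N) :
    IsSide ({(a : ZMod N), (b : ZMod N)} : Finset (ZMod N)) ↔ b = a + 1 ∨ b = a + N - 1 := by
  constructor
  · rintro ⟨z, hz⟩
    rw [pair_eq_pair] at hz
    rcases hz with ⟨rfl, hb⟩ | ⟨ha, rfl⟩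
    · left
      rw [← Int.cast_one, ← Int.cast_add, intCast_eq_of_window (a := a)] at hb <;> omega
    · right
      rw [← Int.cast_one, ← Int.cast_add, ← intCast_add_self a,
        intCast_eq_of_window (a := a + 1)] at ha <;> omega
  · rintro (rfl | rfl)
    · exact ⟨a, by push_cast; rfl⟩
    · refine ⟨((a + N - 1 : ℤ) : ZMod N), ?_⟩
      rw [Finset.pair_comm]
      congr 2
      push_cast
      simp

theorem isDiagonal_intCast {a b : ℤ} (h1 : a < b) (h2 : b < a + N) :
    IsDiagonal ({(a : ZMod N), (b : ZMod N)} : Finset (ZMod N)) ↔ a + 2 ≤ b ∧ b + 2 ≤ a + N := by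
  have hne : (a : ZMod N) ≠ b := by
    rw [Ne, intCast_eq_of_window (a := a)] <;> omega
  unfold IsDiagonal
  rw [isSide_intCast h1 h2, Finset.card_pair hne]
  omega

/-- `D` is a dissection invariant under the rotation by `M` steps. -/
def IsSymmDissection (M : ℕ) (D : Finset (Finset (ZMod N))) : Prop :=
  IsDissection D ∧ ((M : ℕ) : ZMod N) +ᵥ D = D

theorem IsSymmDissection.card_eq_two {D : Finset (Finset (ZMod N))}
    (hD : IsSymmDissection M D) :
    ∀ e ∈ D, e.card = 2 := fun e he => (hD.1.1 e he).1

variable [NeZero N]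

theorem val_sub_intCast {a b : ℤ} (h1 : a ≤ b) (h2 : b < a + N) :
    ((((b : ZMod N) - (a : ZMod N)).val : ℕ) : ℤ) = b - a := by
  rw [← Int.cast_sub, ZMod.val_intCast, Int.emod_eq_of_lt (by omega) (by omega)]

theorem between_intCast {a b c : ℤ} (h1 : a ≤ b) (h2 : b < a + N) (h3 : a ≤ c) (h4 : c < a + N) :
    Between (a : ZMod N) b c ↔ a < b ∧ b < c := by
  have hb := val_sub_intCast h1 h2
  have hc := val_sub_intCast h3 h4
  unfold Between
  omega

theorem exists_lift (a : ℤ) (z : ZMod N) : ∃ b : ℤ, a ≤ b ∧ b < a + N ∧ (b : ZMod N) = z := by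
  refine ⟨a + ((z - (a : ZMod N)).val : ℕ), by omega, ?_, ?_⟩
  · have := ZMod.val_lt (z - (a : ZMod N))
    omega
  · push_cast
    simp

theorem crosses_intCast {a b c d : ℤ} (h1 : a < c) (h2 : c < b) (h3 : b < d) (h4 : d < a + N) :
    Crosses ({(a : ZMod N), (b : ZMod N)} : Finset (ZMod N)) {(c : ZMod N), (d : ZMod N)} := by
  refine ⟨a, b, c, d, rfl, rfl, ?_, ?_⟩
  · rw [between_intCast] <;> omega
  · rw [← intCast_add_self a, between_intCast] <;> omega

theorem Crosses.exists_lifts {e f : Finset (ZMod N)} (h : Crosses e f) : ∃ a b c d : ℤ,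
    a < c ∧ c < b ∧ b < d ∧ d < a + N ∧ e = {(a : ZMod N), (b : ZMod N)} ∧
      f = {(c : ZMod N), (d : ZMod N)} := by
  obtain ⟨a, b, c, d, rfl, rfl, h1, h2⟩ := h
  obtain ⟨a, -, -, rfl⟩ := exists_lift 0 a
  obtain ⟨b, hb, hb', rfl⟩ := exists_lift a b
  obtain ⟨c, hc, hc', rfl⟩ := exists_lift a c
  obtain ⟨d, hd, hd', rfl⟩ := exists_lift b d
  rw [between_intCast] at h1 <;> try omega
  -- The lift a + N, unlike a, lies in the window starting at b.
  rw [← intCast_add_self a, between_intCast] at h2 <;> try omega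
  exact ⟨a, b, c, d, by omega, by omega, by omega, by omega, rfl, rfl⟩

theorem vadd_eq_self_iff {D : Finset (Finset (ZMod N))} (hD : ∀ e ∈ D, e.card = 2) (k : ℤ) :
    (k : ZMod N) +ᵥ D = D ↔ ∀ a b : ℤ,
      ({((a + k : ℤ) : ZMod N), ((b + k : ℤ) : ZMod N)} : Finset (ZMod N)) ∈ D ↔
        ({(a : ZMod N), (b : ZMod N)} : Finset (ZMod N)) ∈ D := by
  constructor
  · intro h a b
    conv_lhs => rw [← h]
    push_cast
    rw [← vadd_pair, Finset.vadd_mem_vadd_finset_iff]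
  · intro h
    have hsub : (k : ZMod N) +ᵥ D ⊆ D := by
      intro e he
      obtain ⟨f, hf, rfl⟩ := Finset.mem_vadd_finset.1 he
      obtain ⟨x, y, -, rfl⟩ := Finset.card_eq_two.1 (hD f hf)
      obtain ⟨a, -, -, rfl⟩ := exists_lift 0 x
      obtain ⟨b, -, -, rfl⟩ := exists_lift 0 y
      have := (h a b).2 hf
      push_cast at this
      rwa [vadd_pair]
    exact Finset.eq_of_subset_of_card_le hsub (by rw [Finset.card_vadd_finset])

/-- The lifts to the integers of the diagonals in `D`, of length at most `M`. -/
def Arc (M : ℕ) (D : Finset (Finset (ZMod N))) (a b : ℤ) : Prop :=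
  a + 2 ≤ b ∧ b ≤ a + M ∧ ({(a : ZMod N), (b : ZMod N)} : Finset (ZMod N)) ∈ D

open Classical in
/-- The set of diagonals described by a system of arcs. -/
noncomputable def toDissection (N : ℕ) [NeZero N] (A : ℤ → ℤ → Prop) :
    Finset (Finset (ZMod N)) :=
  Finset.univ.filter fun e => ∃ a b : ℤ, A a b ∧ e = {(a : ZMod N), (b : ZMod N)}

theorem mem_toDissection {A : ℤ → ℤ → Prop} {e : Finset (ZMod N)} : e ∈ toDissection N A ↔
    ∃ a b : ℤ, A a b ∧ e = {(a : ZMod N), (b : ZMod N)} := by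
  simp [toDissection]

theorem periodic_arc {M : ℕ} {D : Finset (Finset (ZMod N))} {k : ℤ}
    (hD : ∀ e ∈ D, e.card = 2) (h : (k : ZMod N) +ᵥ D = D) (a b : ℤ) :
    Arc M D (a + k) (b + k) ↔ Arc M D a b := by
  unfold Arc
  rw [(vadd_eq_self_iff hD k).1 h]
  refine and_congr (by omega) (and_congr (by omega) Iff.rfl)

end Lifts

theorem IsArcSystem.periodic_mul {M : ℕ} {A : ℤ → ℤ → Prop} (hA : IsArcSystem M A) {N : ℕ}
    (hN : N = 2 * M) (k a b : ℤ) : A (a + N * k) (b + N * k) ↔ A a b := by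
  have h : Function.Periodic (fun t => A (a + t) (b + t)) (M : ℤ) := fun t => by
    have := hA.periodic (a + t) (b + t)
    simp only [← add_assoc]
    exact propext this
  have := h.int_mul (2 * k) 0
  simp only [add_zero, zero_add, eq_iff_iff] at this
  rw [← this]
  subst hN
  push_cast
  ring_nf

section Correspondence

variable {N M : ℕ} [NeZero N] (hN : N = 2 * M) (hM : 2 ≤ M)
include hN

theorem IsSymmDissection.isArcSystem {D : Finset (Finset (ZMod N))}
    (hD : IsSymmDissection M D) : IsArcSystem M (Arc M D) where
  add_two_le h := h.1
  le_add h := h.2.1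
  periodic := periodic_arc hD.card_eq_two (by simpa using hD.2)
  noncrossing := by
    rintro a b c d h h' hac hcb hbd
    have h1 := h.2.1
    have h2 := h'.2.1
    exact hD.1.2 _ h.2.2 _ h'.2.2 (crosses_intCast hac hcb hbd (by omega))

omit [NeZero N] in
theorem IsSymmDissection.mem_iff {D : Finset (Finset (ZMod N))} (hD : IsSymmDissection M D)
    -- A segment has two complementary lifts, of lengths b - a and N - (b - a), and one of them has
    -- length at most M; for a diameter both do.
    {a b : ℤ} (h1 : a < b) (h2 : b < a + N) :
    ({(a : ZMod N), (b : ZMod N)} : Finset (ZMod N)) ∈ D ↔ Arc M D a b ∨ Arc M D b (a + N) := by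
  constructor
  · intro h
    have hd := (isDiagonal_intCast h1 h2).1 (hD.1.1 _ h)
    rcases le_or_gt b (a + M) with hle | hgt
    · exact Or.inl ⟨hd.1, hle, h⟩
    · refine Or.inr ⟨hd.2, by omega, ?_⟩
      rwa [intCast_add_self, Finset.pair_comm]
  · rintro (h | h)
    · exact h.2.2
    · have := h.2.2
      rwa [intCast_add_self, Finset.pair_comm] at this

theorem IsArcSystem.mem_toDissection_iff {A : ℤ → ℤ → Prop} (hA : IsArcSystem M A)
    {x y : ℤ} (h1 : x < y) (h2 : y < x + N) :
    ({(x : ZMod N), (y : ZMod N)} : Finset (ZMod N)) ∈ toDissection N A ↔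
      A x y ∨ A y (x + N) := by
  simp only [mem_toDissection]
  constructor
  · rintro ⟨a, b, hab, he⟩
    have h3 := hA.add_two_le hab
    have h4 := hA.le_add hab
    rw [pair_eq_pair] at he
    simp only [ZMod.intCast_eq_intCast_iff_dvd_sub] at he
    rcases he with ⟨⟨j, hj⟩, hk⟩ | ⟨hk, ⟨j, hj⟩⟩
    · left
      have h5 : (b - a) - (y - x) = 0 := by
        refine Int.eq_zero_of_abs_lt_dvd (m := N) ?_ (by rw [abs_lt]; omega)
        have := dvd_sub hk (Dvd.intro j hj.symm)
        rwa [show b - y - (a - x) = (b - a) - (y - x) by ring] at this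
      rw [← hA.periodic_mul hN j]
      convert hab using 1 <;> omega
    · right
      have h5 : (b - a) - (x + N - y) = 0 := by
        refine Int.eq_zero_of_abs_lt_dvd (m := N) ?_ (by rw [abs_lt]; omega)
        have := dvd_sub (dvd_sub hk (Dvd.intro j hj.symm)) (dvd_refl (N : ℤ))
        rwa [show b - x - (a - y) - N = (b - a) - (x + N - y) by ring] at this
      rw [← hA.periodic_mul hN j]
      convert hab using 1 <;> omega
  · rintro (h | h)
    · exact ⟨x, y, h, rfl⟩
    · exact ⟨y, x + N, h, by rw [intCast_add_self, Finset.pair_comm]⟩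

theorem IsArcSystem.arc_toDissection {A : ℤ → ℤ → Prop} (hA : IsArcSystem M A) :
    Arc M (toDissection N A) = A := by
  ext a b
  constructor
  · rintro ⟨h1, h2, h3⟩
    rw [hA.mem_toDissection_iff hN (by omega) (by omega)] at h3
    rcases h3 with h3 | h3
    · exact h3
    -- Both complementary lengths are at most M, so this is a diameter, and translation by M
    -- exchanges its two lifts.
    · have := hA.le_add h3
      rw [← hA.periodic]
      convert h3 using 1 <;> omega
  · intro h
    have h1 := hA.add_two_le h
    have h2 := hA.le_add h
    exact ⟨h1, h2, (hA.mem_toDissection_iff hN (by omega) (by omega)).2 (Or.inl h)⟩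

include hM in
theorem IsArcSystem.isSymmDissection {A : ℤ → ℤ → Prop} (hA : IsArcSystem M A) :
    IsSymmDissection M (toDissection N A) := by
  have hdiag : ∀ e ∈ toDissection N A, IsDiagonal e := by
    intro e he
    obtain ⟨a, b, h, rfl⟩ := mem_toDissection.1 he
    have h1 := hA.add_two_le h
    have h2 := hA.le_add h
    -- With M ≥ 2, an arc of length at most M = N/2 leaves at least two steps on the other side.
    exact (isDiagonal_intCast (by omega) (by omega)).2 (by omega)
  refine ⟨⟨hdiag, ?_⟩, ?_⟩
  · intro e he f hf hcr
    obtain ⟨a, b, c, d, hac, hcb, hbd, hda, rfl, rfl⟩ := hcr.exists_lifts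
    rw [hA.mem_toDissection_iff hN (by omega) (by omega)] at he hf
    rcases he with he | he <;> rcases hf with hf | hf
    · exact hA.noncrossing he hf hac hcb hbd
    · rw [← hA.periodic_mul hN 1] at he
      exact hA.noncrossing hf he (by omega) (by omega) (by omega)
    · exact hA.noncrossing hf he hcb hbd hda
    · exact hA.noncrossing he hf hbd hda (by omega)
  · have := (vadd_eq_self_iff (fun e he => (hdiag e he).1) (M : ℤ)).2 fun a b => ?_
    · simpa using this
    · simp only [mem_toDissection]
      constructor
      · rintro ⟨x, y, h, he⟩
        refine ⟨x - M, y - M, (hA.periodic _ _).1 (by simpa using h), ?_⟩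
        rw [pair_eq_pair] at he ⊢
        push_cast at he ⊢
        simpa only [eq_sub_iff_add_eq] using he
      · rintro ⟨x, y, h, he⟩
        refine ⟨x + M, y + M, (hA.periodic _ _).2 h, ?_⟩
        rw [pair_eq_pair] at he ⊢
        push_cast
        simpa only [add_left_inj] using he

theorem IsSymmDissection.toDissection_arc {D : Finset (Finset (ZMod N))}
    (hD : IsSymmDissection M D) : toDissection N (Arc M D) = D := by
  ext e
  constructor
  · intro he
    obtain ⟨a, b, h, rfl⟩ := mem_toDissection.1 he
    exact h.2.2
  · intro he
    obtain ⟨x, y, hxy, rfl⟩ := Finset.card_eq_two.1 (hD.card_eq_two _ he)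
    obtain ⟨a, -, -, rfl⟩ := exists_lift 0 x
    obtain ⟨b, hb, hb', rfl⟩ := exists_lift a y
    have hlt : a < b := lt_of_le_of_ne hb fun h => hxy (by rw [h])
    rw [(hD.isArcSystem hN).mem_toDissection_iff hN hlt hb']
    exact (hD.mem_iff hN hlt hb').1 he

end Correspondence

/-! ### The subpolygons of a symmetric dissection -/

section Subgons

variable {N : ℕ} [NeZero N]

theorem adjacent_intCast {S : Finset (ZMod N)} {x y : ℤ} (h1 : x < y) (h2 : y < x + N) :
    Adjacent S (x : ZMod N) y ↔ (∀ z : ℤ, x < z → z < y → (z : ZMod N) ∉ S) ∨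
      ∀ z : ℤ, y < z → z < x + N → (z : ZMod N) ∉ S := by
  have key : ∀ {x y : ℤ}, x < y → y < x + N → ((∀ c ∈ S, ¬ Between (x : ZMod N) c y) ↔
      ∀ z : ℤ, x < z → z < y → (z : ZMod N) ∉ S) := by
    intro x y h1 h2
    constructor
    · intro h z hxz hzy hz
      exact h _ hz ((between_intCast (by omega) (by omega) (by omega) (by omega)).2 ⟨hxz, hzy⟩)
    · intro h c hc hb
      obtain ⟨z, hz, hz', rfl⟩ := exists_lift x c
      rw [between_intCast (by omega) (by omega) (by omega) (by omega)] at hb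
      exact h z hb.1 hb.2 hc
  unfold Adjacent
  rw [key h1 h2]
  have := key (x := y) (y := x + N) (by omega) (by omega)
  rw [intCast_add_self] at this
  rw [this]

omit [NeZero N] in
theorem adjacent_comm {S : Finset (ZMod N)} {a b : ZMod N} : Adjacent S a b ↔ Adjacent S b a :=
  or_comm

/-- The segment between `x` and `y` is a side or a diagonal in the dissection with arcs `A`. -/
def IsEdge (N : ℕ) (A : ℤ → ℤ → Prop) (x y : ℤ) : Prop :=
  y = x + 1 ∨ y = x + N - 1 ∨ A x y ∨ A y (x + N)

/-- Adjacency and edges are symmetric in the two vertices, so ordered pairs in one window of N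
integers suffice; the origin o can be chosen to suit S. -/
theorem IsSymmDissection.isSubgon_iff {M : ℕ} (hN : N = 2 * M)
    {D : Finset (Finset (ZMod N))} (hD : IsSymmDissection M D) (S : Finset (ZMod N)) (o : ℤ) :
    IsSubgon D S ↔ 3 ≤ S.card ∧ ∀ x y : ℤ, o ≤ x → x < y → y < o + N → (x : ZMod N) ∈ S →
      (y : ZMod N) ∈ S → (((∀ z : ℤ, x < z → z < y → (z : ZMod N) ∉ S) ∨
        ∀ z : ℤ, y < z → z < x + N → (z : ZMod N) ∉ S) ↔ IsEdge N (Arc M D) x y) := by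
  have key : ∀ {x y : ℤ}, x < y → y < x + N → ((Adjacent S (x : ZMod N) y ↔
      IsSide {(x : ZMod N), (y : ZMod N)} ∨ ({(x : ZMod N), (y : ZMod N)} : Finset _) ∈ D) ↔
      (((∀ z : ℤ, x < z → z < y → (z : ZMod N) ∉ S) ∨
        ∀ z : ℤ, y < z → z < x + N → (z : ZMod N) ∉ S) ↔ IsEdge N (Arc M D) x y)) := by
    intro x y h1 h2
    rw [adjacent_intCast h1 h2, isSide_intCast h1 h2, hD.mem_iff hN h1 h2, IsEdge, or_assoc]
  unfold IsSubgon
  refine and_congr Iff.rfl ⟨fun h x y hox hxy hyo hx hy => ?_, fun h a ha b hb hab => ?_⟩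
  · refine (key hxy (by omega)).1 (h _ hx _ hy ?_)
    rw [Ne, intCast_eq_of_window (a := o)] <;> omega
  · obtain ⟨x, hx, hx', rfl⟩ := exists_lift o a
    obtain ⟨y, hy, hy', rfl⟩ := exists_lift o b
    rcases lt_trichotomy x y with hlt | rfl | hlt
    · exact (key hlt (by omega)).2 (h x y hx hlt hy' ha hb)
    · exact absurd rfl hab
    · have := (key hlt (by omega)).2 (h y x hy hlt hx' hb ha)
      rwa [adjacent_comm, Finset.pair_comm]

open Classical in
/-- The vertices of the subpolygon lying directly below the arc `(a, b)`. -/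
noncomputable def cellSet (N : ℕ) (A : ℤ → ℤ → Prop) (a b : ℤ) : Finset (ZMod N) :=
  (insert a (insert b ((Finset.Ioo a b).filter fun c => Parent A c a b))).image
    (fun z : ℤ => (z : ZMod N))

open Classical in
/-- The vertices of the central subpolygon. -/
noncomputable def centralSet (N : ℕ) (A : ℤ → ℤ → Prop) : Finset (ZMod N) :=
  ((Finset.Ico (0 : ℤ) N).filter fun c => ¬ ∃ a, Under A c a).image
    (fun z : ℤ => (z : ZMod N))

/-- Points of `P` that are consecutive. -/
def Consecutive (P : ℤ → Prop) (p q : ℤ) : Prop :=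
  p < q ∧ P p ∧ P q ∧ ∀ z, p < z → z < q → ¬ P z

theorem exists_consecutive {P : ℤ → Prop} {p₀ c q₀ : ℤ} (hp : P p₀) (hq : P q₀) (h1 : p₀ < c)
    (h2 : c < q₀) (hc : ¬ P c) :
    ∃ p q, p₀ ≤ p ∧ p < c ∧ c < q ∧ q ≤ q₀ ∧ Consecutive P p q := by
  classical
  obtain ⟨p, hp', hmax⟩ := Finset.exists_max_image ((Finset.Ico p₀ c).filter P) id
    ⟨p₀, by simp [hp, h1]⟩
  obtain ⟨q, hq', hmin⟩ := Finset.exists_min_image ((Finset.Ioc c q₀).filter P) id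
    ⟨q₀, by simp [hq, h2]⟩
  simp only [Finset.mem_filter, Finset.mem_Ico, Finset.mem_Ioc, id] at hp' hq' hmax hmin
  refine ⟨p, q, hp'.1.1, hp'.1.2, hq'.1.1, hq'.1.2, by omega, hp'.2, hq'.2, fun z hz1 hz2 hz => ?_⟩
  rcases lt_trichotomy z c with hlt | rfl | hlt
  · have := hmax z ⟨by omega, hz⟩
    omega
  · exact hc hz
  · have := hmin z ⟨by omega, hz⟩
    omega

theorem card_le_two_of_gaps {S : Finset (ZMod N)} {x y : ℤ}
    (h1 : ∀ z : ℤ, x < z → z < y → (z : ZMod N) ∉ S)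
    (h2 : ∀ z : ℤ, y < z → z < x + N → (z : ZMod N) ∉ S) : S.card ≤ 2 := by
  have hsub : S ⊆ {(x : ZMod N), (y : ZMod N)} := by
    intro c hc
    obtain ⟨z, hz, hz', rfl⟩ := exists_lift x c
    rw [Finset.mem_insert, Finset.mem_singleton]
    by_contra hne
    rw [not_or] at hne
    rcases lt_trichotomy z y with hlt | rfl | hlt
    · exact h1 z (lt_of_le_of_ne hz fun h => hne.1 (by rw [h])) hlt hc
    · exact hne.2 rfl
    · exact h2 z hlt hz' hc
  exact (Finset.card_le_card hsub).trans Finset.card_le_two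

/-! ### Vertices of the cells and of the central polygon -/

section

variable {M : ℕ} (hN : N = 2 * M) {A : ℤ → ℤ → Prop} (hA : IsArcSystem M A)
include hN hA

omit [NeZero N] in
theorem IsArcSystem.mem_cellSet {a b : ℤ} (hab : A a b) {x : ℤ} (h1 : a ≤ x) (h2 : x < a + N) :
    (x : ZMod N) ∈ cellSet N A a b ↔ x = a ∨ x = b ∨ Parent A x a b := by
  have h3 := hA.add_two_le hab
  have h4 := hA.le_add hab
  simp only [cellSet, Finset.mem_image, Finset.mem_insert, Finset.mem_filter, Finset.mem_Ioo]
  constructor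
  · rintro ⟨z, hz, hzx⟩
    rw [intCast_eq_of_window (a := a) (by omega) (by omega) h1 h2] at hzx
    subst hzx
    tauto
  · intro h
    refine ⟨x, ?_, rfl⟩
    rcases h with h | h | h
    · exact Or.inl h
    · exact Or.inr (Or.inl h)
    · exact Or.inr (Or.inr ⟨⟨h.2.1, h.2.2.1⟩, h⟩)

theorem IsArcSystem.cellSet_add {a b : ℤ} (hab : A a b) (k : ℤ) :
    cellSet N A (a + N * k) (b + N * k) = cellSet N A a b := by
  have hper := hA.periodic_mul hN k
  ext c
  obtain ⟨x, h1, h2, rfl⟩ := exists_lift a c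
  rw [hA.mem_cellSet hN hab h1 h2, show (x : ZMod N) = ((x + N * k : ℤ) : ZMod N) by simp,
    hA.mem_cellSet hN ((hper a b).2 hab) (by omega) (by omega), periodic_parent hper,
    add_left_inj, add_left_inj]

omit [NeZero N] in
theorem IsArcSystem.card_cellSet {a b : ℤ} (hab : A a b) :
    (cellSet N A a b).card = cellSize A a b + 2 := by
  have h3 := hA.add_two_le hab
  have h4 := hA.le_add hab
  rw [cellSet, Finset.card_image_of_injOn, Finset.card_insert_of_notMem,
    Finset.card_insert_of_notMem, cellSize]
  · simp
  · simp
    omega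
  · intro x hx y hy hxy
    simp only [Finset.coe_insert, Finset.coe_filter, Finset.mem_Ioo, Set.mem_insert_iff,
      Set.mem_ofPred_eq] at hx hy
    exact (intCast_eq_of_window (a := a) (by omega) (by omega) (by omega) (by omega)).1 hxy

theorem IsArcSystem.mem_centralSet {x : ℤ} :
    (x : ZMod N) ∈ centralSet N A ↔ ¬ ∃ a, Under A x a := by
  have hper : ∀ k z : ℤ, (∃ a, Under A (z + N * k) a) ↔ ∃ a, Under A z a := by
    intro k z
    have h := periodic_under (k := N * k) fun a b => hA.periodic_mul hN k a b
    exact ⟨fun ⟨a, ha⟩ => ⟨a - N * k, (h _ _).1 (by simpa using ha)⟩,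
      fun ⟨a, ha⟩ => ⟨a + N * k, (h _ _).2 ha⟩⟩
  simp only [centralSet, Finset.mem_image, Finset.mem_filter, Finset.mem_Ico]
  constructor
  · rintro ⟨z, hz, hzx⟩
    obtain ⟨k, hk⟩ := (ZMod.intCast_eq_intCast_iff_dvd_sub _ _ _).1 hzx
    rw [show x = z + N * k by omega, hper]
    exact hz.2
  · intro h
    obtain ⟨z, h1, h2, hz⟩ := exists_lift 0 (x : ZMod N)
    refine ⟨z, ⟨⟨h1, by omega⟩, ?_⟩, hz⟩
    obtain ⟨k, hk⟩ := (ZMod.intCast_eq_intCast_iff_dvd_sub _ _ _).1 hz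
    rwa [show x = z + N * k by omega, hper] at h

omit [NeZero N] in
open Classical in
theorem IsArcSystem.card_centralSet : (centralSet N A).card +
    2 * ∑ a ∈ Finset.Ico (0 : ℤ) M, weight (code M A) a = 2 * M := by
  rw [centralSet, Finset.card_image_of_injOn, ← hA.card_covered, Finset.card_filter,
    Finset.card_filter, sum_Ico_split (x := M) (by omega) (by omega)]
  · have hper : ∀ z : ℤ, (∃ a, Under A (z + M) a) ↔ ∃ a, Under A z a := by
      intro z
      have h := periodic_under hA.periodic
      exact ⟨fun ⟨a, ha⟩ => ⟨a - M, (h _ _).1 (by simpa using ha)⟩,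
        fun ⟨a, ha⟩ => ⟨a + M, (h _ _).2 ha⟩⟩
    have e := sum_Ico_add (fun c => if ¬ ∃ a, Under A c a then 1 else 0) 0 M M
    rw [zero_add, show (M + M : ℤ) = N by omega] at e
    rw [e]
    simp_rw [hper]
    have : ∑ c ∈ Finset.Ico (0 : ℤ) M, (if ¬ ∃ a, Under A c a then 1 else 0) +
        ∑ c ∈ Finset.Ico (0 : ℤ) M, (if ∃ a, Under A c a then 1 else 0) = M := by
      rw [← Finset.sum_add_distrib]
      trans ∑ c ∈ Finset.Ico (0 : ℤ) M, 1
      · refine Finset.sum_congr rfl fun c _ => ?_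
        by_cases h : ∃ a, Under A c a <;> simp [h]
      · simp
    omega
  · intro x hx y hy hxy
    simp only [Finset.coe_filter, Finset.mem_Ico, Set.mem_ofPred_eq] at hx hy
    exact (intCast_eq_of_window (a := 0) (by omega) (by omega) (by omega) (by omega)).1 hxy

end

/-- If every point between `x` and `y` lies strictly below an arc that lies above neither `x` nor
`y`, then `(x, y)` is an arc. -/
theorem IsArcSystem.arc_of_covered {M : ℕ} {A : ℤ → ℤ → Prop} (hA : IsArcSystem M A) {x y : ℤ}
    (hxy : x + 1 < y) (h : ∀ z, x < z → z < y → ∃ u v, A u v ∧ u < z ∧ z < v ∧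
      ¬ (u < x ∧ x < v) ∧ ¬ (u < y ∧ y < v)) : A x y := by
  classical
  have hne : ((Finset.Ioc x y).filter fun v => A x v).Nonempty := by
    obtain ⟨u, v, huv, h1, h2, h3, h4⟩ := h (x + 1) (by omega) hxy
    obtain rfl : u = x := by omega
    exact ⟨v, by simp only [Finset.mem_filter, Finset.mem_Ioc]; exact ⟨by omega, huv⟩⟩
  obtain ⟨v, hv, hmax⟩ := Finset.exists_max_image _ id hne
  simp only [Finset.mem_filter, Finset.mem_Ioc, id] at hv hmax
  rcases hv.1.2.eq_or_lt with rfl | hlt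
  · exact hv.2
  · obtain ⟨u, w, huw, h1, h2, h3, h4⟩ := h v hv.1.1 hlt
    -- The arc (u, w) covers the end v of the longest arc from x within (x, y]. It cannot start
    -- after x without crossing, nor cover x or y, so it starts at x and contradicts maximality.
    have h5 : ¬ x < u := fun h5 => hA.noncrossing hv.2 huw h5 h1 h2
    obtain rfl : u = x := by omega
    have := hmax w ⟨by omega, huw⟩
    omega

/-! ### Classification of the subpolygons -/

section

variable {M : ℕ} (hN : N = 2 * M) (hM : 2 ≤ M) {D : Finset (Finset (ZMod N))}
  (hD : IsSymmDissection M D)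
include hN hM hD

theorem IsSymmDissection.isSubgon_cellSet {a b : ℤ} (hab : Arc M D a b) :
    IsSubgon D (cellSet N (Arc M D) a b) := by
  have hA := hD.isArcSystem hN
  have h3 := hA.add_two_le hab
  have h4 := hA.le_add hab
  rw [hD.isSubgon_iff hN _ a]
  refine ⟨by rw [hA.card_cellSet hN hab]; have := hA.cellSize_pos hab; omega, ?_⟩
  intro x y hax hxy hya hx hy
  have hmem := fun {z : ℤ} (h1 : a ≤ z) (h2 : z < a + N) => hA.mem_cellSet hN hab h1 h2
  have hub : ∀ {z : ℤ}, a ≤ z → z < a + N → (z : ZMod N) ∈ cellSet N (Arc M D) a b → z ≤ b := by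
    intro z h1 h2 hz
    rcases (hmem h1 h2).1 hz with h | h | h
    · omega
    · omega
    · exact h.2.2.1.le
  have hcov : ∀ {z u v : ℤ}, a ≤ z → z < a + N → (z : ZMod N) ∈ cellSet N (Arc M D) a b →
      Arc M D u v → a ≤ u → v ≤ b → ¬ (u = a ∧ v = b) → ¬ (u < z ∧ z < v) := by
    intro z u v h1 h2 hz huv hau hvb hne hz'
    rcases (hmem h1 h2).1 hz with h | h | h
    · omega
    · omega
    · have := h.2.2.2 u v huv hz'.1 hz'.2
      omega
  have ha : ((a + N : ℤ) : ZMod N) ∈ cellSet N (Arc M D) a b := by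
    rw [intCast_add_self, hmem le_rfl (by omega)]
    exact Or.inl rfl
  have hb : (b : ZMod N) ∈ cellSet N (Arc M D) a b :=
    (hmem (by omega) (by omega)).2 (Or.inr (Or.inl rfl))
  have hyb := hub (by omega) hya hy
  by_cases heq : x = a ∧ y = b
  · obtain ⟨rfl, rfl⟩ := heq
    refine iff_of_true (Or.inr fun z hz1 hz2 hz => ?_) (Or.inr (Or.inr (Or.inl hab)))
    have := hub (by omega) hz2 hz
    omega
  -- Going round the outside from y to x one meets b or a, so only the inner stretch between x and y
  -- can be free of vertices.
  · have hno : ¬ ∀ z : ℤ, y < z → z < x + N → (z : ZMod N) ∉ cellSet N (Arc M D) a b := by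
      intro h
      rcases hyb.eq_or_lt with rfl | hlt
      · exact h _ (by omega) (by omega) ha
      · exact h _ hlt (by omega) hb
    rw [or_iff_left hno]
    have hedge : IsEdge N (Arc M D) x y ↔ y = x + 1 ∨ Arc M D x y := by
      unfold IsEdge
      constructor
      · rintro (h | h | h | h)
        · exact Or.inl h
        · omega
        · exact Or.inr h
        · have := hA.le_add h
          omega
      · tauto
    rw [hedge]
    constructor
    · intro hgap
      by_contra hne
      rw [not_or] at hne
      refine hne.2 (hA.arc_of_covered (by omega) fun z hxz hzy => ?_)
      obtain ⟨u, v, hp⟩ := hA.exists_parent hab (c := z) (by omega) (by omega)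
      have hle := hp.2.2.2 a b hab (by omega) (by omega)
      have huv : ¬ (u = a ∧ v = b) := by
        rintro ⟨rfl, rfl⟩
        exact hgap z hxz hzy ((hmem (by omega) (by omega)).2 (Or.inr (Or.inr hp)))
      exact ⟨u, v, hp.1, hp.2.1, hp.2.2.1, hcov hax (by omega) hx hp.1 hle.1 hle.2 huv,
        hcov (by omega) hya hy hp.1 hle.1 hle.2 huv⟩
    · rintro (rfl | h) z hxz hzy hz
      · omega
      · exact hcov (by omega) (by omega) hz h hax hyb heq ⟨hxz, hzy⟩

omit hM in
theorem IsSymmDissection.cellSet_injective {a b a' b' : ℤ} (h : Arc M D a b) (h' : Arc M D a' b')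
    (h1 : a ≤ a') (h2 : a' < a + N) (heq : cellSet N (Arc M D) a b = cellSet N (Arc M D) a' b') :
    a = a' ∧ b = b' := by
  have hA := hD.isArcSystem hN
  have hb := h.1
  have hb' := h'.1
  have hM1 := h.2.1
  have hM2 := h'.2.1
  have hle : ∀ {a b : ℤ}, Arc M D a b → ∀ z, a ≤ z → z < a + N →
      (z : ZMod N) ∈ cellSet N (Arc M D) a b → z ≤ b := by
    intro a b h z hz1 hz2 hz
    have h3 := h.1
    rcases (hA.mem_cellSet hN h hz1 hz2).1 hz with h | h | h
    · omega
    · omega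
    · exact h.2.2.1.le
  have ha_mem : ∀ {a b : ℤ}, Arc M D a b → (a : ZMod N) ∈ cellSet N (Arc M D) a b := fun h =>
    (hA.mem_cellSet hN h le_rfl (by omega)).2 (Or.inl rfl)
  have hb_mem : ∀ {a b : ℤ}, Arc M D a b → (b : ZMod N) ∈ cellSet N (Arc M D) a b := fun h =>
    (hA.mem_cellSet hN h (by have := h.1; omega) (by have := h.2.1; omega)).2 (Or.inr (Or.inl rfl))
  have h3 := hle h a' h1 h2 (heq ▸ ha_mem h')
  rcases h1.eq_or_lt with rfl | hlt
  · have h4 := hle h b' (by omega) (by omega) (heq ▸ hb_mem h')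
    have h5 := hle h' b (by omega) (by omega) (heq ▸ hb_mem h)
    exact ⟨rfl, by omega⟩
  · exfalso
    have h4 := hle h' (a + N) (by omega) (by omega) (by
      rw [intCast_add_self, ← heq]
      exact ha_mem h)
    -- The bounds force a' = b = a + M and b' = a + N: the cells lie on opposite sides of a diameter
    -- and could share only its endpoints.
    have hcard : (cellSet N (Arc M D) a b).card ≤ 2 := by
      refine card_le_two_of_gaps (x := a) (y := b) (fun z hz1 hz2 hz => ?_) fun z hz1 hz2 hz => ?_
      · have := hle h' (z + N) (by omega) (by omega) (by rwa [intCast_add_self, ← heq])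
        omega
      · have := hle h z (by omega) hz2 hz
        omega
    rw [hA.card_cellSet hN h] at hcard
    have := hA.cellSize_pos h
    omega

/-- Lift S periodically. A gap of length at least M between consecutive vertices is closed by an arc
over all of S, which is then the cell below it. Otherwise every side lifts to a unit step or an arc,
and S consists of the uncovered points. -/
theorem IsSymmDissection.eq_of_isSubgon {S : Finset (ZMod N)} (hS : IsSubgon D S) :
    (∃ a b : ℤ, 0 ≤ a ∧ a < N ∧ Arc M D a b ∧ S = cellSet N (Arc M D) a b) ∨
      S = centralSet N (Arc M D) := by
  have hA := hD.isArcSystem hN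
  set P : ℤ → Prop := fun z => (z : ZMod N) ∈ S with hP
  have hperP : ∀ z, P (z + N) ↔ P z := fun z => by simp only [hP, intCast_add_self]
  have hcard := ((hD.isSubgon_iff hN S 0).1 hS).1
  have hadj : ∀ x y : ℤ, x < y → y < x + N → P x → P y → (((∀ z : ℤ, x < z → z < y → ¬ P z) ∨
      ∀ z : ℤ, y < z → z < x + N → ¬ P z) ↔ IsEdge N (Arc M D) x y) :=
    fun x y h1 h2 h3 h4 => ((hD.isSubgon_iff hN S x).1 hS).2 x y le_rfl h1 h2 h3 h4
  have hshort : ∀ {p q : ℤ}, Consecutive P p q → q < p + N := by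
    intro p q h
    by_contra hlt
    have := card_le_two_of_gaps (S := S) (x := p) (y := p + 1) (fun z _ _ => by omega)
      fun z h1 h2 => h.2.2.2 z (by omega) (by omega)
    omega
  have hcons : ∀ {p q : ℤ}, Consecutive P p q → q < p + M → q = p + 1 ∨ Arc M D p q := by
    intro p q h hlt
    rcases (hadj p q h.1 (hshort h) h.2.1 h.2.2.1).1 (Or.inl h.2.2.2) with h | h | h | h
    · exact Or.inl h
    · omega
    · exact Or.inr h
    · have := hA.le_add h
      omega
  by_cases hlong : ∃ y z, Consecutive P y z ∧ y + M ≤ z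
  · left
    obtain ⟨y, z, hyz, hle⟩ := hlong
    have hzy := hshort hyz
    have harc : Arc M D z (y + N) := by
      rcases (hadj y z hyz.1 hzy hyz.2.1 hyz.2.2.1).1 (Or.inl hyz.2.2.2) with h | h | h | h
      · omega
      · exfalso
        have := card_le_two_of_gaps (S := S) (x := y) (y := z) hyz.2.2.2 fun _ _ _ => by omega
        omega
      · have := hA.le_add h
        obtain rfl : z = y + M := by omega
        rw [← hA.periodic] at h
        rwa [show y + (N : ℤ) = y + M + M by omega]
      · exact h
    have hy' : P (y + N) := (hperP y).2 hyz.2.1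
    have hgap : ∀ x, y + N < x → x < z + N → ¬ P x := fun x h1 h2 h3 =>
      hyz.2.2.2 (x - N) (by omega) (by omega) ((hperP _).1 (by simpa using h3))
    generalize hb : y + (N : ℤ) = b at *
    obtain ⟨a, rfl⟩ : ∃ a, a = z := ⟨z, rfl⟩
    have hPa : P a := hyz.2.2.1
    have hab := harc.1
    have habM := harc.2.1
    have hne : ¬ ∀ x, a < x → x < b → ¬ P x := fun h => by
      have := card_le_two_of_gaps (S := S) h hgap
      omega
    have hmem : ∀ x, a < x → x < b → (P x ↔ Parent (Arc M D) x a b) := by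
      intro x hax hxb
      constructor
      · intro hx
        obtain ⟨u, v, hp⟩ := hA.exists_parent harc hax hxb
        have hle := hp.2.2.2 a b harc hax hxb
        have hux := hp.2.1
        have hxv := hp.2.2.1
        by_cases huv : u = a ∧ v = b
        · rwa [huv.1, huv.2] at hp
        · exfalso
          -- If an end of the parent (u, v) of x were not a vertex of S, a side of S would pass over
          -- it and cross (u, v). With both ends in S, the diagonal makes them adjacent, yet x and
          -- one of a, b separate them.
          have hPu : P u := by
            by_contra hu
            have : a ≠ u := fun h => hu (h ▸ hPa)
            obtain ⟨p, q, h1, h2, h3, h4, h5⟩ :=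
              exists_consecutive hPa hx (by omega) hux hu
            rcases hcons h5 (by omega) with h | h
            · omega
            · exact hA.noncrossing h hp.1 h2 h3 (by omega)
          have hPv : P v := by
            by_contra hv
            have : v ≠ b := fun h => hv (h ▸ hy')
            obtain ⟨p, q, h1, h2, h3, h4, h5⟩ :=
              exists_consecutive hx hy' hxv (by omega) hv
            rcases hcons h5 (by omega) with h | h
            · omega
            · exact hA.noncrossing hp.1 h (by omega) h2 h3
          rcases (hadj u v (by omega) (by omega) hPu hPv).2 (Or.inr (Or.inr (Or.inl hp.1)))
            with h | h
          · exact h x hux hxv hx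
          · rcases hle.2.eq_or_lt with rfl | hlt
            · exact h (a + N) (by omega) (by omega) ((hperP a).2 hPa)
            · exact h b hlt (by omega) hy'
      · intro hp
        by_contra hx
        obtain ⟨p, q, h1, h2, h3, h4, h5⟩ := exists_consecutive hPa hy' hax hxb hx
        have hpq : ¬ (p = a ∧ q = b) := by
          rintro ⟨rfl, rfl⟩
          exact hne h5.2.2.2
        rcases hcons h5 (by omega) with h | h
        · omega
        · have := hp.2.2.2 p q h h2 h3
          omega
    have hSeq : S = cellSet N (Arc M D) a b := by
      ext c
      obtain ⟨x, h1, h2, rfl⟩ := exists_lift a c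
      rw [hA.mem_cellSet hN harc h1 h2]
      change P x ↔ _
      rcases h1.eq_or_lt with rfl | hax
      · exact iff_of_true hPa (Or.inl rfl)
      · rcases lt_trichotomy x b with hxb | rfl | hxb
        · rw [hmem x hax hxb]
          exact ⟨fun h => Or.inr (Or.inr h), fun h => by
            rcases h with h | h | h
            · omega
            · omega
            · exact h⟩
        · exact iff_of_true hy' (Or.inr (Or.inl rfl))
        · refine iff_of_false (hgap x hxb h2) ?_
          rintro (h | h | h)
          · omega
          · omega
          · have := h.2.2.1
            omega
    -- Translate by a multiple of N to bring the start of the arc into [0, N); the cell does not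
    -- change.
    have hN0 : (0 : ℤ) < N := by omega
    have hmod : a = a % (N : ℤ) + N * (a / N) := (Int.emod_add_mul_ediv a N).symm
    have harc' : Arc M D (a % (N : ℤ)) (b - N * (a / N)) := by
      rw [← hA.periodic_mul hN (a / N), ← hmod, sub_add_cancel]
      exact harc
    refine ⟨a % (N : ℤ), b - N * (a / N), Int.emod_nonneg _ hN0.ne', Int.emod_lt_of_pos _ hN0,
      harc', ?_⟩
    rw [hSeq, ← hA.cellSet_add hN harc' (a / N), ← hmod, sub_add_cancel]
  · right
    push Not at hlong
    ext c
    obtain ⟨x, -, -, rfl⟩ := exists_lift 0 c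
    rw [hA.mem_centralSet hN]
    change P x ↔ _
    obtain ⟨s, hs⟩ : S.Nonempty := Finset.card_pos.1 (by omega)
    constructor
    · rintro hx ⟨u, v, hp⟩
      have hux := hp.2.1
      have hxv := hp.2.2.1
      have huv := hA.le_add hp.1
      have hPu : P u := by
        by_contra hu
        obtain ⟨p, q, h1, h2, h3, h4, h5⟩ := exists_consecutive (p₀ := x - N) (c := u)
          ((hperP _).1 (by simpa using hx)) hx (by omega) hux hu
        rcases hcons h5 (hlong p q h5) with h | h
        · omega
        · exact hA.noncrossing h hp.1 h2 h3 (by omega)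
      have hPv : P v := by
        by_contra hv
        obtain ⟨p, q, h1, h2, h3, h4, h5⟩ := exists_consecutive hx ((hperP x).2 hx) hxv (by omega) hv
        rcases hcons h5 (hlong p q h5) with h | h
        · omega
        · exact hA.noncrossing hp.1 h (by omega) h2 h3
      rcases (hadj u v (by omega) (by omega) hPu hPv).2 (Or.inr (Or.inr (Or.inl hp.1))) with h | h
      · exact h x hux hxv hx
      · have := hlong v (u + N) ⟨by omega, hPv, (hperP u).2 hPu, h⟩
        omega
    · intro hx
      by_contra hnx
      obtain ⟨p₀, h1, h2, rfl⟩ := exists_lift (x - N) s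
      have hne : p₀ + N ≠ x := fun h => hnx (h ▸ (hperP p₀).2 hs)
      obtain ⟨p, q, h1, h2, h3, h4, h5⟩ := exists_consecutive (P := P) hs ((hperP p₀).2 hs)
        (c := x) (by omega) (by omega) hnx
      rcases hcons h5 (hlong p q h5) with h | h
      · omega
      · obtain ⟨a, b, hp⟩ := hA.exists_parent h h2 h3
        exact hx ⟨a, b, hp⟩

end

end Subgons

/-! ### Sums of periodic functions -/

theorem sum_Ico_zmod {R : Type*} [AddCommMonoid R] {r : ℕ} [NeZero r] (g : ZMod r → R) (a : ℤ) :
    ∑ k ∈ Finset.Ico a (a + r), g k = ∑ x, g x := by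
  refine Finset.sum_bij (fun k _ => (k : ZMod r)) (fun _ _ => Finset.mem_univ _) ?_ ?_
    fun _ _ => rfl
  · intro x hx y hy hxy
    rw [Finset.mem_Ico] at hx hy
    exact (intCast_eq_of_window hx.1 hx.2 hy.1 hy.2).1 hxy
  · intro x _
    obtain ⟨b, h1, h2, h3⟩ := exists_lift a x
    exact ⟨b, Finset.mem_Ico.2 ⟨h1, h2⟩, h3⟩

theorem sum_Ico_mul_zmod {R : Type*} [AddCommMonoid R] {r : ℕ} [NeZero r] (g : ZMod r → R)
    (e : ℕ) (a : ℤ) : ∑ k ∈ Finset.Ico a (a + (e * r : ℕ)), g k = e • ∑ x, g x := by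
  induction e with
  | zero => simp
  | succ e ih =>
    rw [sum_Ico_split (x := a + (e * r : ℕ)) (by omega) (by rw [add_mul]; omega), ih, add_mul,
      one_mul, Nat.cast_add, ← add_assoc, sum_Ico_zmod, add_smul, one_smul]

theorem periodic_eq_val {R : Type*} {r : ℕ} [NeZero r] {f : ℤ → R} (hf : ∀ a, f (a + r) = f a)
    (a : ℤ) : f ((a : ZMod r).val : ℕ) = f a := by
  have hp : Function.Periodic f (r : ℤ) := hf
  rw [ZMod.val_intCast]
  have := hp.int_mul (a / (r : ℤ)) (a % (r : ℤ))
  rw [mul_comm, Int.cast_id, Int.emod_add_mul_ediv] at this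
  exact this.symm

theorem sum_Ico_periodic {R : Type*} [AddCommMonoid R] {M : ℕ} [NeZero M] {f : ℤ → R}
    (hf : ∀ a, f (a + M) = f a) (a : ℤ) :
    ∑ k ∈ Finset.Ico a (a + M), f k = ∑ k ∈ Finset.Ico 0 (M : ℤ), f k := by
  have h : ∀ a : ℤ, ∑ k ∈ Finset.Ico a (a + M), f k = ∑ x : ZMod M, f (x.val : ℕ) := fun a => by
    rw [← sum_Ico_zmod _ a]
    exact Finset.sum_congr rfl fun k _ => (periodic_eq_val hf k).symm
  rw [h, ← h 0, zero_add]

theorem sum_gaps {V : Finset ℕ} (hV : 0 ∉ V) : (gaps V).sum = V.sup id := by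
  obtain ⟨l, hl, rfl⟩ := exists_partialSums V hV
  rw [gaps_partialSums hl, sup_partialSums, Multiset.sum_coe]

/-- The gaps of a code in one period. -/
noncomputable def totalGaps (M : ℕ) (V : ℤ → Finset ℕ) : Multiset ℕ := ∑ a ∈ Finset.Ico (0 : ℤ) M, gaps (V a)

theorem sum_weight_eq {M : ℕ} {V : ℤ → Finset ℕ} (h0 : ∀ a, 0 ∉ V a) :
    ∑ a ∈ Finset.Ico (0 : ℤ) M, weight V a = (totalGaps M V).sum := by
  rw [totalGaps, ← Multiset.coe_sumAddMonoidHom, map_sum]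
  exact Finset.sum_congr rfl fun a _ => (sum_gaps (h0 a)).symm

theorem isCode_of_sum_lt {M : ℕ} [NeZero M] {V : ℤ → Finset ℕ} (hper : ∀ a, V (a + M) = V a)
    (h0 : ∀ a, 0 ∉ V a) (hsum : (totalGaps M V).sum < M) : IsCode M V where
  periodic := hper
  zero_notMem := h0
  sum_lt a := by
    have hw : ∀ a, (weight V (a + M) : ℤ) = weight V a := fun a => by rw [weight, weight, hper]
    rw [sum_Ico_periodic (f := fun k => (weight V k : ℤ)) hw, ← Nat.cast_sum, sum_weight_eq h0]
    exact_mod_cast hsum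

/-! ### Counting subpolygons -/

section Count

variable {N M : ℕ} [NeZero N] (hN : N = 2 * M) (hM : 2 ≤ M) {D : Finset (Finset (ZMod N))}
  (hD : IsSymmDissection M D)
include hN hM hD

/-- The arcs starting in [0, N) fill two M-periods and have distinct cells, giving exactly twice the
count on the right. The central polygon adds at most one, which rounding down discards. -/
theorem IsSymmDissection.ncard_subgons (j : ℕ) :
    {S | IsSubgon D S ∧ S.card = j + 2}.ncard / 2 =
      (totalGaps M (code M (Arc M D))).count j := by
  classical
  have hA := hD.isArcSystem hN
  set A := Arc M D
  let F : Finset (Σ _ : ℤ, ℤ) := (Finset.Ico (0 : ℤ) N).sigma fun a =>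
    (arcEnds M A a).filter fun b => j = cellSize A a b
  have hF : ∀ x : Σ _ : ℤ, ℤ, x ∈ F ↔ (0 ≤ x.1 ∧ x.1 < N) ∧ A x.1 x.2 ∧ j = cellSize A x.1 x.2 :=
    fun x => by simp only [F, Finset.mem_sigma, Finset.mem_Ico, Finset.mem_filter, hA.mem_arcEnds]
  have hcard : F.card = 2 * (totalGaps M (code M A)).count j := by
    have h1 : ∀ a, ((arcEnds M A a).filter fun b => j = cellSize A a b).card =
        (gaps (code M A a)).count j := fun a => by
      rw [hA.gaps_code, Multiset.count_map]
      rfl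
    rw [Finset.card_sigma, Finset.sum_congr rfl fun a _ => h1 a, totalGaps, Multiset.count_sum',
      sum_Ico_split (x := (M : ℤ)) (by omega) (by omega)]
    have h2 := sum_Ico_add (fun a => (gaps (code M A a)).count j) 0 M M
    rw [zero_add, show (M + M : ℤ) = N by omega] at h2
    simp_rw [h2, hA.periodic_code hA.periodic]
    rw [two_mul]
  have hinj : Set.InjOn (fun x : Σ _ : ℤ, ℤ => cellSet N A x.1 x.2) F := by
    rintro ⟨a, b⟩ hx ⟨a', b'⟩ hy hxy
    have hx := (hF _).1 hx
    have hy := (hF _).1 hy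
    simp only at hx hy hxy
    have : a = a' ∧ b = b' := by
      rcases le_total a a' with hle | hle
      · exact hD.cellSet_injective hN hx.2.1 hy.2.1 hle (by omega) hxy
      · have := hD.cellSet_injective hN hy.2.1 hx.2.1 hle (by omega) hxy.symm
        exact ⟨this.1.symm, this.2.symm⟩
    obtain ⟨rfl, rfl⟩ := this
    rfl
  have hlow : (F.image fun x => cellSet N A x.1 x.2 : Set (Finset (ZMod N))) ⊆
      {S | IsSubgon D S ∧ S.card = j + 2} := by
    intro S hS
    obtain ⟨x, hx, rfl⟩ := Finset.mem_image.1 hS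
    have hx := (hF _).1 hx
    exact ⟨hD.isSubgon_cellSet hN hM hx.2.1, by rw [hA.card_cellSet hN hx.2.1, ← hx.2.2]⟩
  have hupp : {S | IsSubgon D S ∧ S.card = j + 2} ⊆
      (insert (centralSet N A) (F.image fun x => cellSet N A x.1 x.2) :
        Finset (Finset (ZMod N))) := by
    rintro S ⟨hS, hSj⟩
    rw [Finset.mem_coe, Finset.mem_insert]
    rcases hD.eq_of_isSubgon hN hM hS with ⟨a, b, h1, h2, hab, rfl⟩ | rfl
    · refine Or.inr (Finset.mem_image.2 ⟨⟨a, b⟩, (hF _).2 ⟨⟨h1, h2⟩, hab, ?_⟩, rfl⟩)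
      rw [hA.card_cellSet hN hab] at hSj
      simp only
      omega
    · exact Or.inl rfl
  have hl := Set.ncard_le_ncard hlow (Set.toFinite _)
  have hu := Set.ncard_le_ncard hupp (Finset.finite_toSet _)
  rw [Set.ncard_coe_finset, Finset.card_image_of_injOn hinj, hcard] at hl
  rw [Set.ncard_coe_finset] at hu
  have hu' := hu.trans (Finset.card_insert_le _ _)
  rw [Finset.card_image_of_injOn hinj, hcard] at hu'
  omega

theorem IsSymmDissection.card_of_isSubgon {S : Finset (ZMod N)} (hS : IsSubgon D S) :
    (∃ j ∈ totalGaps M (code M (Arc M D)), S.card = j + 2) ∨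
      S.card + 2 * (totalGaps M (code M (Arc M D))).sum = 2 * M := by
  have hA := hD.isArcSystem hN
  rcases hD.eq_of_isSubgon hN hM hS with ⟨a, b, h1, h2, hab, rfl⟩ | rfl
  · left
    have hmem : ∀ {a b : ℤ}, 0 ≤ a → a < M → Arc M D a b →
        cellSize (Arc M D) a b ∈ totalGaps M (code M (Arc M D)) := by
      intro a b h1 h2 hab
      rw [totalGaps, Multiset.mem_sum]
      refine ⟨a, Finset.mem_Ico.2 ⟨h1, h2⟩, ?_⟩
      rw [hA.gaps_code]
      exact Multiset.mem_map_of_mem _ (hA.mem_arcEnds.2 hab)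
    refine ⟨_, ?_, hA.card_cellSet hN hab⟩
    rcases lt_or_ge a M with h3 | h3
    · exact hmem h1 h3 hab
    · rw [← sub_add_cancel a (M : ℤ), ← sub_add_cancel b (M : ℤ),
        periodic_cellSize hA.periodic]
      exact hmem (by omega) (by omega) ((hA.periodic _ _).1 (by simpa using hab))
  · right
    rw [← sum_weight_eq hA.zero_notMem_code]
    exact hA.card_centralSet hN

end Count

/-! ### Faces of a given type -/

section Faces

variable {m n t : ℕ} (lam : t.Partition)

theorem two_mul_mul_add_two (m n : ℕ) : 2 * m * n + 2 = 2 * (m * n + 1) := by ring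

/-- The dissection with a given code. -/
noncomputable def dissectionOf (m n : ℕ) (V : ℤ → Finset ℕ) :
    Finset (Finset (ZMod (2 * m * n + 2))) :=
  toDissection (2 * m * n + 2) (arcsOf V)

theorem code_dissectionOf {V : ℤ → Finset ℕ} (hV : IsCode (m * n + 1) V) :
    code (m * n + 1) (Arc (m * n + 1) (dissectionOf m n V)) = V := by
  rw [dissectionOf, hV.isArcSystem.arc_toDissection (two_mul_mul_add_two m n), hV.code_arcsOf]

theorem count_map_mul (hm : 1 ≤ m) (k : ℕ) :
    (lam.parts.map (m * ·)).count (m * k) = lam.parts.count k :=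
  Multiset.count_map_eq_count' _ _ (fun _ _ h => Nat.eq_of_mul_eq_mul_left hm h) _

theorem mem_facesOfType_iff_totalGaps (hm : 1 ≤ m) (hn : 1 ≤ n) (ht : t ≤ n)
    {D : Finset (Finset (ZMod (2 * m * n + 2)))} :
    D ∈ facesOfType m n lam ↔ IsSymmDissection (m * n + 1) D ∧
      totalGaps (m * n + 1) (code (m * n + 1) (Arc (m * n + 1) D)) = lam.parts.map (m * ·) := by
  have hN := two_mul_mul_add_two m n
  have hM : 2 ≤ m * n + 1 := by nlinarith
  constructor
  · rintro ⟨⟨hD, hsym, hdiv⟩, htype⟩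
    have hS : IsSymmDissection (m * n + 1) D := ⟨hD, hsym⟩
    refine ⟨hS, Multiset.ext.2 fun j => ?_⟩
    rw [← hS.ncard_subgons hN hM]
    by_cases hj : m ∣ j
    · obtain ⟨k, rfl⟩ := hj
      rw [count_map_mul lam hm, htype]
      rfl
    · rw [Multiset.count_eq_zero.2, show {S | IsSubgon D S ∧ S.card = j + 2} = ∅ from
        Set.eq_empty_iff_forall_notMem.2 fun S h => ?_, Set.ncard_empty]
      · obtain ⟨k, hk⟩ := hdiv S h.1
        have := h.2
        exact hj ⟨k, by omega⟩
      · intro h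
        obtain ⟨k, -, rfl⟩ := Multiset.mem_map.1 h
        exact hj (dvd_mul_right _ _)
  · rintro ⟨hS, hgaps⟩
    refine ⟨⟨hS.1, hS.2, fun S hSub => ?_⟩, fun k => ?_⟩
    · rcases hS.card_of_isSubgon hN hM hSub with ⟨j, hj, hcard⟩ | hcard
      · rw [hgaps] at hj
        obtain ⟨k, -, rfl⟩ := Multiset.mem_map.1 hj
        exact ⟨k, hcard⟩
      · rw [hgaps, Multiset.sum_map_mul_left, Multiset.map_id', lam.parts_sum] at hcard
        obtain ⟨s, rfl⟩ := Nat.exists_eq_add_of_le ht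
        -- The central polygon has 2M - 2mt = 2m(n - t) + 2 vertices, so its divisibility is
        -- automatic.
        exact ⟨2 * s, by nlinarith⟩
    · rw [← count_map_mul lam hm, ← hgaps, ← hS.ncard_subgons hN hM]
      rfl

theorem sum_map_mul_lt (ht : t ≤ n) : (lam.parts.map (m * ·)).sum < m * n + 1 := by
  rw [Multiset.sum_map_mul_left, Multiset.map_id', lam.parts_sum]
  have := Nat.mul_le_mul_left m ht
  omega

theorem mem_facesOfType_iff (hm : 1 ≤ m) (hn : 1 ≤ n) (ht : t ≤ n)
    {D : Finset (Finset (ZMod (2 * m * n + 2)))} :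
    D ∈ facesOfType m n lam ↔ ∃ V, IsCode (m * n + 1) V ∧
      totalGaps (m * n + 1) V = lam.parts.map (m * ·) ∧ dissectionOf m n V = D := by
  have hN := two_mul_mul_add_two m n
  have hM : 2 ≤ m * n + 1 := by nlinarith
  rw [mem_facesOfType_iff_totalGaps lam hm hn ht]
  constructor
  · rintro ⟨hS, hgaps⟩
    have hA := hS.isArcSystem hN
    refine ⟨_, isCode_of_sum_lt (hA.periodic_code hA.periodic) hA.zero_notMem_code ?_, hgaps, ?_⟩
    · rw [hgaps]
      exact sum_map_mul_lt lam ht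
    · rw [dissectionOf, hA.arcsOf_code, hS.toDissection_arc hN]
  · rintro ⟨V, hV, hgaps, rfl⟩
    rw [code_dissectionOf hV]
    exact ⟨hV.isArcSystem.isSymmDissection hN hM, hgaps⟩

end Faces

/-! ### Rotation of dissections as translation of codes -/

theorem vadd_toDissection {N : ℕ} [NeZero N] {A A' : ℤ → ℤ → Prop} {k : ℤ}
    (h : ∀ a b, A' (a + k) (b + k) ↔ A a b) :
    (k : ZMod N) +ᵥ toDissection N A = toDissection N A' := by
  ext e
  rw [Finset.mem_vadd_finset]
  constructor
  · rintro ⟨f, hf, rfl⟩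
    obtain ⟨a, b, hab, rfl⟩ := mem_toDissection.1 hf
    refine mem_toDissection.2 ⟨a + k, b + k, (h a b).2 hab, ?_⟩
    rw [vadd_pair]
    push_cast
    rfl
  · intro he
    obtain ⟨a, b, hab, rfl⟩ := mem_toDissection.1 he
    refine ⟨_, mem_toDissection.2 ⟨a - k, b - k, (h _ _).1 (by simpa using hab), rfl⟩, ?_⟩
    rw [vadd_pair]
    push_cast
    simp

theorem vadd_dissectionOf (m n : ℕ) (V : ℤ → Finset ℕ) (k : ℤ) :
    (k : ZMod (2 * m * n + 2)) +ᵥ dissectionOf m n V = dissectionOf m n fun a => V (a - k) :=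
  vadd_toDissection (arcsOf_add fun a => by rw [add_sub_cancel_right])

theorem IsCode.sub {M : ℕ} [NeZero M] {V : ℤ → Finset ℕ} (hV : IsCode M V) (k : ℤ) :
    IsCode M fun a => V (a - k) where
  periodic a := by rw [add_sub_right_comm, hV.periodic]
  zero_notMem a := hV.zero_notMem _
  sum_lt a := by
    have h := hV.sum_lt (a - k)
    rw [sub_eq_add_neg, add_right_comm, sum_Ico_add] at h
    exact h

theorem totalGaps_sub {M : ℕ} [NeZero M] {V : ℤ → Finset ℕ} (hV : ∀ a, V (a + M) = V a) (k : ℤ) :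
    totalGaps M (fun a => V (a - k)) = totalGaps M V := by
  have h := sum_Ico_periodic (f := fun a => gaps (V a)) (fun a => by rw [hV]) (0 + -k)
  rw [add_right_comm, sum_Ico_add, zero_add] at h
  exact h

theorem dissectionOf_injective {m n : ℕ} {V V' : ℤ → Finset ℕ}
    (hV : IsCode (m * n + 1) V) (hV' : IsCode (m * n + 1) V')
    (h : dissectionOf m n V = dissectionOf m n V') : V = V' := by
  rw [← code_dissectionOf hV, h, code_dissectionOf hV']

/-! ### Faces fixed by a rotation -/

/-- The periodic code whose words are those of `c`, with all letters multiplied by `m`. -/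
def codeOfWords (m : ℕ) {r : ℕ} (c : ZMod r → List ℕ) (a : ℤ) : Finset ℕ :=
  partialSums ((c (a : ZMod r)).map (m * ·))

theorem pos_of_mem_map {m : ℕ} (hm : 1 ≤ m) {l : List ℕ} (hl : ∀ i ∈ l, 0 < i) :
    ∀ i ∈ l.map (m * ·), 0 < i := by
  intro i hi
  obtain ⟨j, hj, rfl⟩ := List.mem_map.1 hi
  exact Nat.mul_pos hm (hl j hj)

theorem totalGaps_codeOfWords {m : ℕ} (hm : 1 ≤ m) {r : ℕ} [NeZero r] {c : ZMod r → List ℕ}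
    (hc : ∀ x, ∀ i ∈ c x, 0 < i) (e : ℕ) :
    totalGaps (e * r) (codeOfWords m c) = (e • ∑ x, (c x : Multiset ℕ)).map (m * ·) := by
  have h := sum_Ico_mul_zmod (fun x => gaps (partialSums ((c x).map (m * ·)))) e 0
  rw [zero_add] at h
  rw [totalGaps]
  refine h.trans ?_
  rw [Multiset.map_nsmul, ← Multiset.coe_mapAddMonoidHom, map_sum]
  congr 1
  exact Finset.sum_congr rfl fun x _ => gaps_partialSums (pos_of_mem_map hm (hc x))

theorem codeOfWords_injective {m : ℕ} (hm : 1 ≤ m) {r : ℕ} [NeZero r] {c c' : ZMod r → List ℕ}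
    (hc : ∀ x, ∀ i ∈ c x, 0 < i) (hc' : ∀ x, ∀ i ∈ c' x, 0 < i)
    (h : codeOfWords m c = codeOfWords m c') : c = c' := by
  funext x
  obtain ⟨a, -, -, rfl⟩ := exists_lift 0 x
  exact List.map_injective_iff.2 (fun _ _ h => Nat.eq_of_mul_eq_mul_left hm h)
    (partialSums_injective (pos_of_mem_map hm (hc _)) (pos_of_mem_map hm (hc' _)) (congrFun h a))

section Fixed

variable {m n t : ℕ} (hm : 1 ≤ m) (hn : 1 ≤ n) (ht : t ≤ n) (lam : t.Partition) {r e k : ℕ}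
  [NeZero r] (hM : m * n + 1 = e * r) (hr : r = Nat.gcd (m * n + 1) k)
include hM

theorem pos_of_nsmul_sum_eq {c : ZMod r → List ℕ}
    (hc : e • ∑ x, (c x : Multiset ℕ) = lam.parts) : ∀ x, ∀ i ∈ c x, 0 < i := by
  intro x i hi
  apply lam.parts_pos
  have he : e ≠ 0 := by rintro rfl; simp at hM
  rw [← hc, Multiset.mem_nsmul_of_ne_zero he, Multiset.mem_sum]
  exact ⟨x, Finset.mem_univ _, hi⟩

include hm

include ht in
theorem isCode_codeOfWords {c : ZMod r → List ℕ}
    (hc : e • ∑ x, (c x : Multiset ℕ) = lam.parts) : IsCode (m * n + 1) (codeOfWords m c) := by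
  have hpos := pos_of_nsmul_sum_eq lam hM hc
  refine isCode_of_sum_lt (fun a => ?_) (fun a => zero_notMem_partialSums
    (pos_of_mem_map hm (hpos _))) ?_
  · unfold codeOfWords
    rw [hM]
    simp
  · rw [hM, totalGaps_codeOfWords hm hpos, hc, ← hM]
    exact sum_map_mul_lt lam ht

include hn ht hr in
theorem dissectionOf_codeOfWords_mem {c : ZMod r → List ℕ}
    (hc : e • ∑ x, (c x : Multiset ℕ) = lam.parts) :
    dissectionOf m n (codeOfWords m c) ∈ {D ∈ facesOfType m n lam |
      ((k : ℕ) : ZMod (2 * m * n + 2)) +ᵥ D = D} := by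
  have hpos := pos_of_nsmul_sum_eq lam hM hc
  refine ⟨(mem_facesOfType_iff lam hm hn ht).2 ⟨_, isCode_codeOfWords hm ht lam hM hc, ?_, rfl⟩, ?_⟩
  · rw [hM, totalGaps_codeOfWords hm hpos, hc]
  · have h := vadd_dissectionOf m n (codeOfWords m c) k
    rw [Int.cast_natCast] at h
    rw [h]
    congr 1
    funext a
    obtain ⟨j, hj⟩ : r ∣ k := hr ▸ Nat.gcd_dvd_right _ _
    unfold codeOfWords
    rw [hj]
    simp

include hn ht hr in
theorem exists_words_of_fixed {D : Finset (Finset (ZMod (2 * m * n + 2)))}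
    (hD : D ∈ {D ∈ facesOfType m n lam | ((k : ℕ) : ZMod (2 * m * n + 2)) +ᵥ D = D}) :
    ∃ c : ZMod r → List ℕ, e • ∑ x, (c x : Multiset ℕ) = lam.parts ∧
      dissectionOf m n (codeOfWords m c) = D := by
  obtain ⟨hD, hfix⟩ := hD
  obtain ⟨V, hV, hgaps, rfl⟩ := (mem_facesOfType_iff lam hm hn ht).1 hD
  have h := vadd_dissectionOf m n V k
  rw [Int.cast_natCast, hfix] at h
  have hVk := dissectionOf_injective hV (hV.sub k) h
  have hp1 : Function.Periodic V (k : ℤ) := fun a => by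
    have := congrFun hVk (a + k)
    simpa using this
  have hp2 : Function.Periodic V ((m * n + 1 : ℕ) : ℤ) := hV.periodic
  have hper : ∀ a, V (a + r) = V a := by
    intro a
    -- Bézout: the periods M and k combine to the period gcd(M, k) = r.
    have h3 := (hp2.int_mul (Nat.gcdA (m * n + 1) k)).add_period
      (hp1.int_mul (Nat.gcdB (m * n + 1) k)) a
    rw [hr, Nat.gcd_eq_gcd_ab]
    rw [← h3]
    congr 2
    push_cast
    ring
  choose l hl hlV using fun a => exists_partialSums (V a) (hV.zero_notMem a)
  -- As r ≤ M, each representative lies in the period [0, M), so its letters occur among the gaps,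
  -- all multiples of m.
  have hdvd : ∀ x : ZMod r, ∀ i ∈ l (x.val : ℕ), m ∣ i := by
    intro x i hi
    have hmem : i ∈ totalGaps (m * n + 1) V := by
      rw [totalGaps, Multiset.mem_sum]
      refine ⟨(x.val : ℕ), Finset.mem_Ico.2 ⟨by omega, ?_⟩, ?_⟩
      · have h1 := ZMod.val_lt x
        have h2 : r ≤ m * n + 1 := hr ▸ Nat.gcd_le_left _ (by omega)
        omega
      · rw [← hlV, gaps_partialSums (hl _)]
        exact hi
    rw [hgaps] at hmem
    obtain ⟨j, -, rfl⟩ := Multiset.mem_map.1 hmem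
    exact dvd_mul_right _ _
  let c : ZMod r → List ℕ := fun x => (l (x.val : ℕ)).map (· / m)
  have hcl : ∀ x : ZMod r, (c x).map (m * ·) = l (x.val : ℕ) := by
    intro x
    rw [List.map_map]
    conv_rhs => rw [← List.map_id (l (x.val : ℕ))]
    exact List.map_congr_left fun i hi => Nat.mul_div_cancel' (hdvd x i hi)
  have hcpos : ∀ x, ∀ i ∈ c x, 0 < i := by
    intro x i hi
    have := hl (x.val : ℕ) (m * i) (by rw [← hcl]; exact List.mem_map_of_mem hi)
    exact Nat.pos_of_mul_pos_left this
  have hVc : codeOfWords m c = V := by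
    funext a
    rw [codeOfWords, hcl, hlV]
    exact periodic_eq_val hper a
  refine ⟨c, ?_, by rw [hVc]⟩
  rw [← hVc, hM, totalGaps_codeOfWords hm hcpos] at hgaps
  exact Multiset.map_injective (fun _ _ h => Nat.eq_of_mul_eq_mul_left hm h) hgaps

include hn ht hr in
theorem ncard_fixed_of_nsmul {p : Multiset ℕ} (hp : lam.parts = e • p) :
    {D ∈ facesOfType m n lam | ((k : ℕ) : ZMod (2 * m * n + 2)) +ᵥ D = D}.ncard =
      {c : ZMod r → List ℕ | ∑ x, (c x : Multiset ℕ) = p}.ncard := by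
  have he : e ≠ 0 := by rintro rfl; simp at hM
  have hiff : ∀ c : ZMod r → List ℕ, ∑ x, (c x : Multiset ℕ) = p ↔
      e • ∑ x, (c x : Multiset ℕ) = lam.parts := fun c => by
    rw [hp]
    refine ⟨fun h => by rw [h], fun h => Multiset.ext.2 fun i => ?_⟩
    have := congrArg (Multiset.count i) h
    rw [Multiset.count_nsmul, Multiset.count_nsmul] at this
    exact Nat.eq_of_mul_eq_mul_left (Nat.pos_of_ne_zero he) this
  symm
  refine Set.ncard_congr (fun c _ => dissectionOf m n (codeOfWords m c)) ?_ ?_ ?_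
  · intro c hc
    exact dissectionOf_codeOfWords_mem hm hn ht lam hM hr ((hiff c).1 hc)
  · intro c c' hc hc' h
    have hc := (hiff c).1 hc
    have hc' := (hiff c').1 hc'
    exact codeOfWords_injective hm (pos_of_nsmul_sum_eq lam hM hc)
      (pos_of_nsmul_sum_eq lam hM hc') (dissectionOf_injective
        (isCode_codeOfWords hm ht lam hM hc) (isCode_codeOfWords hm ht lam hM hc') h)
  · intro D hD
    obtain ⟨c, hc, rfl⟩ := exists_words_of_fixed hm hn ht lam hM hr hD
    exact ⟨c, (hiff c).2 hc, rfl⟩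

end Fixed

/-! ### The sieving identity -/

theorem vadd_mem_facesOfType {m n t : ℕ} (hm : 1 ≤ m) (hn : 1 ≤ n) (ht : t ≤ n)
    (lam : t.Partition) (g : ZMod (2 * m * n + 2)) {D : Finset (Finset (ZMod (2 * m * n + 2)))}
    (hD : D ∈ facesOfType m n lam) : g +ᵥ D ∈ facesOfType m n lam := by
  obtain ⟨V, hV, hgaps, rfl⟩ := (mem_facesOfType_iff lam hm hn ht).1 hD
  obtain ⟨k, -, -, rfl⟩ := exists_lift 0 g
  rw [vadd_dissectionOf]
  exact (mem_facesOfType_iff lam hm hn ht).2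
    ⟨_, hV.sub k, by rw [totalGaps_sub hV.periodic, hgaps], rfl⟩

/-- The root and k have equal order, hence so do its square and 2k; and 2k has order M / gcd(M, k)
modulo 2M. -/
theorem isPrimitiveRoot_exp_sq {M N k : ℕ} (hN : N = 2 * M) (hM : 0 < M) :
    IsPrimitiveRoot
      (Complex.exp (2 * Real.pi * Complex.I / (addOrderOf (k : ZMod N) : ℂ)) ^ 2)
      (M / M.gcd k) := by
  have hN0 : N ≠ 0 := by omega
  have : NeZero N := ⟨hN0⟩
  have hd : addOrderOf (k : ZMod N) ≠ 0 := (addOrderOf_pos _).ne'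
  have h1 := Complex.isPrimitiveRoot_exp _ hd
  have h2 : addOrderOf (2 • (k : ZMod N)) = M / M.gcd k := by
    rw [show 2 • (k : ZMod N) = ((2 * k : ℕ) : ZMod N) by simp, ZMod.addOrderOf_coe _ hN0, hN,
      Nat.gcd_mul_left, Nat.mul_div_mul_left _ _ (by norm_num)]
  rw [addOrderOf_nsmul] at h2
  have h3 := IsPrimitiveRoot.orderOf
    (Complex.exp (2 * Real.pi * Complex.I / (addOrderOf (k : ZMod N) : ℂ)) ^ 2)
  rwa [orderOf_pow' _ two_ne_zero, ← h1.eq_orderOf, h2] at h3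

theorem exhibitsCSP_facesOfType {m n t : ℕ} (hm : 1 ≤ m) (hn : 1 ≤ n) (ht : t ≤ n)
    (lam : t.Partition) : ExhibitsCSP (C := ZMod (2 * m * n + 2))
      (facesOfType m n lam) (sievingPoly m n lam) := by
  refine ⟨Set.toFinite _, fun g D hD => vadd_mem_facesOfType hm hn ht lam g hD, fun g => ?_⟩
  obtain ⟨k, rfl⟩ : ∃ k : ℕ, (k : ZMod (2 * m * n + 2)) = g := ⟨g.val, ZMod.natCast_zmod_val g⟩
  have hroot := isPrimitiveRoot_exp_sq (k := k) (two_mul_mul_add_two m n) (by omega)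
  obtain ⟨e, he⟩ := Nat.gcd_dvd_left (m * n + 1) k
  have hr0 : 0 < Nat.gcd (m * n + 1) k := Nat.gcd_pos_of_pos_left _ (by omega)
  generalize hr : Nat.gcd (m * n + 1) k = r at he hr0 hroot
  obtain ⟨r, rfl⟩ := Nat.exists_eq_add_of_lt hr0
  rw [zero_add] at *
  rw [he, Nat.mul_div_cancel_left _ (by omega)] at hroot
  have hM : m * n + 1 = e * (r + 1) := by rw [he, mul_comm]
  have he0 : e ≠ 0 := by rintro rfl; simp at hM
  by_cases hdvd : ∀ i, e ∣ lam.parts.count i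
  · obtain ⟨p, hp⟩ : ∃ p : Multiset ℕ, lam.parts = e • p := by
      refine ⟨∑ i ∈ lam.parts.toFinset, Multiset.replicate (lam.parts.count i / e) i,
        Multiset.ext.2 fun i => ?_⟩
      rw [Multiset.count_nsmul, Multiset.count_sum']
      simp only [Multiset.count_replicate, Finset.sum_ite_eq', Multiset.mem_toFinset]
      split_ifs with h
      · exact (Nat.mul_div_cancel' (hdvd i)).symm
      · simpa using h
    have h1 := aeval_sievingPoly_of_dvd m n lam hroot hM hp
    have h2 := ncard_words r p
    rw [ncard_fixed_of_nsmul (r := r + 1) hm hn ht lam hM hr.symm hp]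
    have hne : ((r.factorial : ℂ) * ∏ k ∈ p.toFinset, ((p.count k).factorial : ℂ)) ≠ 0 :=
      mul_ne_zero (by exact_mod_cast Nat.factorial_ne_zero _)
        (Finset.prod_ne_zero_iff.2 fun i _ => by exact_mod_cast Nat.factorial_ne_zero _)
    apply mul_right_cancel₀ hne
    push_cast at h1
    rw [h1, ← h2]
    push_cast
    -- `ZMod (r + 1)` is `Fin (r + 1)` by definition, which identifies the two sets of families of
    -- words.
    rfl
  · push Not at hdvd
    rw [aeval_sievingPoly_of_not_dvd m n lam hroot hM hdvd, eq_comm, Nat.cast_eq_zero,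
      Set.ncard_eq_zero (Set.toFinite _), Set.eq_empty_iff_forall_notMem]
    -- The content of a fixed face is an e-fold multiple, so e would divide every multiplicity.
    intro D hD
    obtain ⟨c, hc, -⟩ := exists_words_of_fixed (r := r + 1) hm hn ht lam hM hr.symm hD
    obtain ⟨i, hi⟩ := hdvd
    exact hi (by rw [← hc, Multiset.count_nsmul]; exact dvd_mul_right _ _)

end ClusterB

theorem theorem6p7 (m n : ℕ) (hm : 1 ≤ m) (hn : 1 ≤ n) (t : ℕ) (ht : t ≤ n) (lam : t.Partition) :
    ClusterB.sievingPoly m n lam *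
        ((ClusterB.lowerIndices m n lam).map
          fun a => (ClusterB.qFactorial a).comp (Polynomial.X ^ 2)).prod =
      (ClusterB.qFactorial (m * n + lam.parts.card)).comp (Polynomial.X ^ 2) ∧
    ClusterB.sievingPoly m n lam *
        ∏ k ∈ lam.parts.toFinset, ∏ i ∈ Finset.Icc 1 (lam.parts.count k), ClusterB.qInt (2 * i) =
      ∏ i ∈ Finset.Icc 1 lam.parts.card, ClusterB.qInt (2 * m * n + 2 * i) ∧
    ClusterB.ExhibitsCSP (C := ZMod (2 * m * n + 2))
      (ClusterB.facesOfType m n lam) (ClusterB.sievingPoly m n lam) :=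
  ⟨ClusterB.sievingPoly_mul m n lam, ClusterB.sievingPoly_mul_prod m n lam,
    ClusterB.exhibitsCSP_facesOfType hm hn ht lam⟩
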